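/- Let $T$ be a homeomorphism of the Cantor space $2^{\mathbb N}$ and let $\nu$ be a non-atomic Borel probability measure on $2^{\mathbb N}$ which is $T$-invariant and ergodic for $T$. Let $[T]_c$ be the topological full group of $T$, that is, the group of all homeomorphisms $U$ of $2^{\mathbb N}$ such that every $x\in 2^{\mathbb N}$ has a neighbourhood on which $U$ coincides with some power $T^n$, $n\in\mathbb Z$. For $x,y$ in the same $T$-orbit put $d_T(x,y)=\min\{|n| : n\in\mathbb Z,\ T^n(x)=y\}$. Let $\mathrm{Aut}(2^{\mathbb N},\nu)$ be the group of all $\nu$-preserving Borel bijections of $2^{\mathbb N}$, two of them being identified if they coincide $\nu$-almost everywhere, and let the $\mathrm L^1$ full group $[T]_1$ be the group of all $S\in \mathrm{Aut}(2^{\mathbb N},\nu)$ such that $S(x)$ lies in the $T$-orbit of $x$ for almost every $x$ and $\int d_T(x,S(x))\,d\nu(x)<\infty$. The group $[T]_1$ carries the topology of the metric $\tilde d_T(S,S')=\int d_T(S(x),S'(x))\,d\nu(x)$. Every element of $[T]_c$ preserves $\nu$ and defines an element of $[T]_1$. Write $D(G)$ for the derived (commutator) subgroup of a group $G$. Then (the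 image of) $[T]_c$ is dense in $[T]_1$, and (the image of) $D([T]_c)$ is dense in the closure $\overline{D([T]_1)}$ of $D([T]_1)$ in $[T]_1$; that is, the closures of $D([T]_c)$ and $D([T]_1)$ in $[T]_1$ coincide. -/

import Mathlib

open MeasureTheory Filter Topology
open scoped ENNReal

namespace L1FullGroup

section Orbit

variable {X : Type*}

/-- The graph distance on the orbits of `T`, i.e. the least length of a word in `T`, `T⁻¹` that
maps `x` to `y`, which is the least `|n|` with `T ^ n x = y`. It is `∞` if `x` and `y` lie in
different orbits. -/
noncomputable def orbitDist (T : Equiv.Perm X) (x y : X) : ℝ≥0∞ :=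
  ⨅ (n : ℤ) (_ : (T ^ n) x = y), (n.natAbs : ℝ≥0∞)

theorem orbitDist_le (T : Equiv.Perm X) {x y : X} {n : ℤ} (h : (T ^ n) x = y) :
    orbitDist T x y ≤ n.natAbs := iInf₂_le n h

theorem orbitDist_self (T : Equiv.Perm X) (x : X) : orbitDist T x x = 0 := by
  simpa using orbitDist_le T (x := x) (y := x) (n := 0) (by simp)

theorem orbitDist_comm_le (T : Equiv.Perm X) (x y : X) : orbitDist T x y ≤ orbitDist T y x := by
  refine le_iInf₂ fun n hn => ?_
  simpa using orbitDist_le T (x := x) (y := y) (n := -n) (by simp [← hn])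

theorem orbitDist_comm (T : Equiv.Perm X) (x y : X) : orbitDist T x y = orbitDist T y x :=
  le_antisymm (orbitDist_comm_le T x y) (orbitDist_comm_le T y x)

theorem orbitDist_triangle (T : Equiv.Perm X) (x y z : X) :
    orbitDist T x z ≤ orbitDist T x y + orbitDist T y z := by
  refine ENNReal.le_iInf₂_add_iInf₂ fun n hn m hm => ?_
  refine (orbitDist_le T (n := m + n) (by simp [zpow_add, hn, hm])).trans ?_
  rw [add_comm (n.natAbs : ℝ≥0∞)]
  exact_mod_cast Int.natAbs_add_le m n

theorem eq_of_orbitDist_eq_zero (T : Equiv.Perm X) {x y : X} (h : orbitDist T x y = 0) :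
    x = y := by
  have h1 : orbitDist T x y < 1 := by simp [h]
  obtain ⟨n, hn⟩ := iInf_lt_iff.1 h1
  obtain ⟨hx, hn⟩ := iInf_lt_iff.1 hn
  have hn' : n.natAbs < 1 := by exact_mod_cast hn
  obtain rfl : n = 0 := by omega
  simpa using hx

end Orbit

section Measured

variable {X : Type*} [MeasurableSpace X]

/-- Measurable bijections of `X` whose inverse is measurable and which preserve `μ`. -/
def mpPerm (μ : Measure X) : Subgroup (Equiv.Perm X) where
  carrier := {f | MeasurePreserving f μ μ ∧ MeasurePreserving f.symm μ μ}
  one_mem' := ⟨MeasurePreserving.id μ, MeasurePreserving.id μ⟩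
  mul_mem' hf hg := ⟨hf.1.comp hg.1, hg.2.comp hf.2⟩
  inv_mem' hf := ⟨hf.2, hf.1⟩

/-- The elements of `mpPerm μ` which coincide with the identity almost everywhere. -/
def aeTrivial (μ : Measure X) : Subgroup (mpPerm μ) where
  carrier := {f | ∀ᵐ x ∂μ, (f : Equiv.Perm X) x = x}
  one_mem' := by simp
  mul_mem' {f g} hf hg := by
    simp only [Set.mem_ofPred_eq] at *
    filter_upwards [hf, hg] with x h1 h2
    simp [h1, h2]
  inv_mem' {f} hf := by
    simp only [Set.mem_ofPred_eq] at *
    filter_upwards [hf] with x h1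
    exact Equiv.Perm.inv_eq_iff_eq.2 h1.symm

theorem aeTrivial_conj {μ : Measure X} (f g : mpPerm μ) (hf : f ∈ aeTrivial μ) :
    g * f * g⁻¹ ∈ aeTrivial μ := by
  have h : ∀ᵐ x ∂μ, (f : Equiv.Perm X) ((g : Equiv.Perm X).symm x) =
      (g : Equiv.Perm X).symm x := g.2.2.quasiMeasurePreserving.ae hf
  change ∀ᵐ x ∂μ, _
  filter_upwards [h] with x hx
  change (g : Equiv.Perm X) ((f : Equiv.Perm X) ((g : Equiv.Perm X).symm x)) = x
  rw [hx, Equiv.apply_symm_apply]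

instance (μ : Measure X) : (aeTrivial μ).Normal := ⟨fun f hf g => aeTrivial_conj f g hf⟩

/-- `Aut(X, μ)`: the group of measure-preserving transformations of `(X, μ)`, two of them being
identified if they coincide almost everywhere. -/
abbrev Aut (μ : Measure X) : Type _ := mpPerm μ ⧸ aeTrivial μ

variable {μ : Measure X}

theorem ae_eq_of_mk_eq {f g : mpPerm μ} (h : (f : Aut μ) = g) :
    ∀ᵐ x ∂μ, (f : Equiv.Perm X) x = (g : Equiv.Perm X) x := by
  have h1 : ∀ᵐ x ∂μ, ((f⁻¹ * g : mpPerm μ) : Equiv.Perm X) x = x := QuotientGroup.eq.1 h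
  filter_upwards [h1] with x hx
  exact (Equiv.Perm.inv_eq_iff_eq.1 hx).symm

/-- `∫ d_T (f x, g x) dμ(x)`. -/
noncomputable def preEDist (T f g : mpPerm μ) : ℝ≥0∞ :=
  ∫⁻ x, orbitDist (T : Equiv.Perm X) ((f : Equiv.Perm X) x) ((g : Equiv.Perm X) x) ∂μ

theorem preEDist_comm (T f g : mpPerm μ) : preEDist T f g = preEDist T g f := by
  simp only [preEDist, orbitDist_comm]

variable [StandardBorelSpace X]

theorem measurable_orbitDist (T f g : mpPerm μ) :
    Measurable fun x => orbitDist (T : Equiv.Perm X) ((f : Equiv.Perm X) x)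
      ((g : Equiv.Perm X) x) := by
  classical
  refine Measurable.iInf fun n => ?_
  have : (fun x => ⨅ _ : ((T : Equiv.Perm X) ^ n) ((f : Equiv.Perm X) x) = (g : Equiv.Perm X) x,
      (n.natAbs : ℝ≥0∞)) =
      fun x => if ((T ^ n * f : mpPerm μ) : Equiv.Perm X) x = (g : Equiv.Perm X) x then
        (n.natAbs : ℝ≥0∞) else ∞ := by
    funext x
    simp only [iInf_eq_if]
    rfl
  rw [this]
  exact Measurable.ite (measurableSet_eq_fun (T ^ n * f).2.1.measurable g.2.1.measurable)
    measurable_const measurable_const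

theorem preEDist_triangle (T f g h : mpPerm μ) :
    preEDist T f h ≤ preEDist T f g + preEDist T g h := by
  unfold preEDist
  rw [← lintegral_add_left (measurable_orbitDist T f g)]
  exact lintegral_mono fun x => orbitDist_triangle _ _ _ _

theorem preEDist_mul_right (T f g h : mpPerm μ) :
    preEDist T (f * h) (g * h) = preEDist T f g :=
  h.2.1.lintegral_comp (measurable_orbitDist T f g)

/-- The measure-preserving bijections `f` such that `f x` lies in the `T`-orbit of `x` for almost
every `x` and `x ↦ d_T (x, f x)` is integrable. -/
noncomputable def preL1 (T : mpPerm μ) : Subgroup (mpPerm μ) where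
  carrier := {f | (∀ᵐ x ∂μ, ∃ n : ℤ, ((T : Equiv.Perm X) ^ n) x = (f : Equiv.Perm X) x) ∧
    ∫⁻ x, orbitDist (T : Equiv.Perm X) x ((f : Equiv.Perm X) x) ∂μ < ∞}
  one_mem' := ⟨Eventually.of_forall fun x => ⟨0, by simp⟩, by simp [orbitDist_self]⟩
  mul_mem' {f g} hf hg := by
    refine ⟨?_, ?_⟩
    · filter_upwards [hg.1, g.2.1.quasiMeasurePreserving.ae hf.1] with x ⟨n, hn⟩ ⟨m, hm⟩
      exact ⟨m + n, by simp [zpow_add, hn, hm]⟩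
    · change preEDist T 1 (f * g) < ∞
      refine (preEDist_triangle T 1 g (f * g)).trans_lt (ENNReal.add_lt_top.2 ⟨hg.2, ?_⟩)
      have := preEDist_mul_right T 1 f g
      rw [one_mul] at this
      rw [this]
      exact hf.2
  inv_mem' {f} hf := by
    refine ⟨?_, ?_⟩
    · filter_upwards [f.2.2.quasiMeasurePreserving.ae hf.1] with x ⟨n, hn⟩
      refine ⟨-n, ?_⟩
      rw [Equiv.apply_symm_apply] at hn
      rw [zpow_neg, Equiv.Perm.inv_eq_iff_eq]
      exact hn.symm
    · change preEDist T 1 f⁻¹ < ∞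
      have := preEDist_mul_right T 1 f⁻¹ f
      rw [one_mul, inv_mul_cancel, preEDist_comm] at this
      rw [← this]
      exact hf.2

/-- The `L¹` full group `[T]₁`, as a subgroup of `Aut(X, μ)`. -/
noncomputable def l1FullGroup (T : mpPerm μ) : Subgroup (Aut μ) :=
  (preL1 T).map (QuotientGroup.mk' (aeTrivial μ))

/-- `∫ d_T (f x, g x) dμ(x)` for classes `f`, `g` in `Aut(X, μ)`. -/
noncomputable def autEDist (T : mpPerm μ) (f g : Aut μ) : ℝ≥0∞ :=
  Quotient.liftOn₂' f g (preEDist T) fun f g f' g' hf hg => by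
    have h1 := ae_eq_of_mk_eq (Quotient.sound' hf : (f : Aut μ) = f')
    have h2 := ae_eq_of_mk_eq (Quotient.sound' hg : (g : Aut μ) = g')
    refine lintegral_congr_ae ?_
    filter_upwards [h1, h2] with x hx hy
    simp only [hx, hy]

/-- The extended form of the metric `d̃_T (f, g) = ∫ d_T (f x, g x) dμ(x)` on `[T]₁`. -/
noncomputable abbrev emetric (T : mpPerm μ) : EMetricSpace (l1FullGroup T) where
  edist f g := autEDist T f g
  edist_self := by
    rintro ⟨_, f, -, rfl⟩
    change preEDist T f f = 0
    simp [preEDist, orbitDist_self]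
  edist_comm := by
    rintro ⟨_, f, -, rfl⟩ ⟨_, g, -, rfl⟩
    exact preEDist_comm T f g
  edist_triangle := by
    rintro ⟨_, f, -, rfl⟩ ⟨_, g, -, rfl⟩ ⟨_, h, -, rfl⟩
    exact preEDist_triangle T f g h
  eq_of_edist_eq_zero {f g} h := by
    obtain ⟨_, f, _, rfl⟩ := f
    obtain ⟨_, g, _, rfl⟩ := g
    have h0 : preEDist T f g = 0 := h
    have h1 := (lintegral_eq_zero_iff (measurable_orbitDist T f g)).1 h0
    refine Subtype.ext (QuotientGroup.eq.2 ?_)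
    change ∀ᵐ x ∂μ, _
    filter_upwards [h1] with x hx
    have := eq_of_orbitDist_eq_zero _ hx
    exact Equiv.Perm.inv_eq_iff_eq.2 this.symm

/-- The metric `d̃_T (f, g) = ∫ d_T (f x, g x) dμ(x)` on `[T]₁`. It defines the topology. -/
noncomputable instance metric (T : mpPerm μ) : MetricSpace (l1FullGroup T) :=
  letI := emetric T
  EMetricSpace.toMetricSpace (by
    rintro ⟨_, f, hf, rfl⟩ ⟨_, g, hg, rfl⟩
    change preEDist T f g ≠ ∞
    refine ((preEDist_triangle T f 1 g).trans_lt (ENNReal.add_lt_top.2 ⟨?_, hg.2⟩)).ne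
    rw [preEDist_comm]
    exact hf.2)

theorem edist_eq (T : mpPerm μ) (f g : l1FullGroup T) : edist f g = autEDist T f g := rfl

end Measured

section Topological

variable {X : Type*} [TopologicalSpace X]

/-- The topological full group `[T]_c`: the homeomorphisms which locally coincide with a power
of `T`. -/
def topFullGroup (T : X ≃ₜ X) : Subgroup (X ≃ₜ X) where
  carrier := {U | ∀ x, ∃ n : ℤ, ∀ᶠ y in 𝓝 x, U y = (T ^ n) y}
  one_mem' x := ⟨0, by simp⟩
  mul_mem' {U V} hU hV x := by
    obtain ⟨n, hn⟩ := hV x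
    obtain ⟨m, hm⟩ := hU (V x)
    refine ⟨m + n, ?_⟩
    filter_upwards [hn, V.continuous.continuousAt.eventually hm] with y h1 h2
    change U (V y) = _
    rw [h2, h1, zpow_add]
    rfl
  inv_mem' {U} hU x := by
    obtain ⟨n, hn⟩ := hU (U.symm x)
    refine ⟨-n, ?_⟩
    filter_upwards [U.symm.continuous.continuousAt.eventually hn] with y h
    rw [Homeomorph.apply_symm_apply] at h
    change U.symm y = (T ^ (-n)) y
    conv_rhs => rw [h]
    rw [zpow_neg]
    exact ((T ^ n).symm_apply_apply _).symm

theorem toEquiv_zpow (T : X ≃ₜ X) (n : ℤ) (x : X) : (T.toEquiv ^ n : Equiv.Perm X) x = (T ^ n) x := by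
  let φ : (X ≃ₜ X) →* Equiv.Perm X :=
    { toFun := Homeomorph.toEquiv, map_one' := rfl, map_mul' := fun _ _ => rfl }
  exact congrArg (fun e : Equiv.Perm X => e x) (map_zpow φ T n).symm

theorem orbitDist_bdd_of_mem [CompactSpace X] (T : X ≃ₜ X) {U : X ≃ₜ X}
    (hU : U ∈ topFullGroup T) : ∃ C : ℕ, ∀ x, orbitDist T.toEquiv x (U x) ≤ C := by
  have h : ∃ C : ℕ, ∀ x ∈ (Set.univ : Set X), orbitDist T.toEquiv x (U x) ≤ C := by
    refine isCompact_univ.induction_on (p := fun s => ∃ C : ℕ, ∀ x ∈ s,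
      orbitDist T.toEquiv x (U x) ≤ C) ⟨0, by simp⟩ ?_ ?_ ?_
    · rintro s t hst ⟨C, hC⟩
      exact ⟨C, fun x hx => hC x (hst hx)⟩
    · rintro s t ⟨C, hC⟩ ⟨D, hD⟩
      refine ⟨max C D, ?_⟩
      rintro x (hx | hx)
      · exact (hC x hx).trans (by exact_mod_cast le_max_left _ _)
      · exact (hD x hx).trans (by exact_mod_cast le_max_right _ _)
    · intro x _
      obtain ⟨n, hn⟩ := hU x
      refine ⟨_, mem_nhdsWithin_of_mem_nhds hn, n.natAbs, fun y hy => ?_⟩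
      exact orbitDist_le _ ((toEquiv_zpow T n y).trans hy.symm)
  obtain ⟨C, hC⟩ := h
  exact ⟨C, fun x => hC x trivial⟩

variable [MeasurableSpace X] [BorelSpace X] {μ : Measure X}

/-- A homeomorphism which preserves `μ`, as a measure-preserving bijection. -/
def homeoMP (T : X ≃ₜ X) (hT : MeasurePreserving T μ μ) : mpPerm μ :=
  ⟨T.toEquiv, hT, hT.symm T.toMeasurableEquiv⟩

theorem homeoMP_zpow (T : X ≃ₜ X) (hT : MeasurePreserving T μ μ) (n : ℤ) :
    MeasurePreserving (T ^ n : X ≃ₜ X) μ μ := by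
  have h := ((homeoMP T hT) ^ n).2.1
  have h2 : (((homeoMP T hT) ^ n : mpPerm μ) : X → X) = (T ^ n : X ≃ₜ X) := by
    funext x
    exact toEquiv_zpow T n x
  rwa [h2] at h

variable [StandardBorelSpace X]

theorem measurePreserving_of_mem (T : X ≃ₜ X) (hT : MeasurePreserving T μ μ) {U : X ≃ₜ X}
    (hU : U ∈ topFullGroup T) : MeasurePreserving U μ μ := by
  refine ⟨U.measurable, ?_⟩
  have hmeas : ∀ n : ℤ, MeasurableSet {x | U x = (T ^ n) x} := fun n =>
    measurableSet_eq_fun U.measurable (T ^ n).measurable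
  let e : ℤ ≃ ℕ := Equiv.intEquivNat
  let A : ℕ → Set X := disjointed fun k => {x | U x = (T ^ (e.symm k)) x}
  have hA : ∀ k, MeasurableSet (A k) := fun k => MeasurableSet.disjointed (fun k => hmeas _) k
  have hAd : Pairwise (Function.onFun Disjoint A) := disjoint_disjointed _
  have hAu : ⋃ k, A k = Set.univ := by
    rw [iUnion_disjointed, Set.eq_univ_iff_forall]
    intro x
    obtain ⟨n, hn⟩ := hU x
    exact Set.mem_iUnion.2 ⟨e n, by simpa using hn.self_of_nhds⟩
  have hAe : ∀ k, ∀ x ∈ A k, U x = (T ^ (e.symm k)) x := fun k x hx => disjointed_subset _ k hx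
  ext B hB
  rw [Measure.map_apply U.measurable hB]
  have hUB : MeasurableSet (U ⁻¹' B) := U.measurable hB
  have hImg : ∀ k, MeasurableSet (U '' (A k)) := fun k =>
    U.toMeasurableEquiv.measurableSet_image.2 (hA k)
  calc μ (U ⁻¹' B) = μ (⋃ k, U ⁻¹' B ∩ A k) := by
        rw [← Set.inter_iUnion, hAu, Set.inter_univ]
    _ = ∑' k, μ (U ⁻¹' B ∩ A k) :=
        measure_iUnion (fun i j hij => (hAd hij).mono Set.inter_subset_right Set.inter_subset_right)
          fun k => hUB.inter (hA k)
    _ = ∑' k, μ (B ∩ U '' (A k)) := by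
        refine tsum_congr fun k => ?_
        rw [← (homeoMP_zpow T hT (e.symm k)).measure_preimage (hB.inter (hImg k)).nullMeasurableSet]
        congr 1
        ext x
        constructor
        · rintro ⟨h1, h2⟩
          rw [Set.mem_preimage, ← hAe k x h2]
          exact ⟨h1, x, h2, rfl⟩
        · rintro ⟨h1, y, hy, h2⟩
          rw [hAe k y hy] at h2
          obtain rfl := (T ^ (e.symm k)).injective h2
          refine ⟨?_, hy⟩
          rw [Set.mem_preimage, hAe k y hy]
          exact h1
    _ = μ (⋃ k, B ∩ U '' (A k)) := by
        refine (measure_iUnion (fun i j hij => ?_) fun k => hB.inter (hImg k)).symm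
        exact ((Set.disjoint_image_iff U.injective).2 (hAd hij)).mono
          Set.inter_subset_right Set.inter_subset_right
    _ = μ B := by
        rw [← Set.inter_iUnion, ← Set.image_iUnion, hAu, Set.image_univ, U.surjective.range_eq,
          Set.inter_univ]

/-- The homomorphism `[T]_c → [T]₁` which maps a homeomorphism to its class modulo equality
almost everywhere. -/
noncomputable def topToL1 [CompactSpace X] [IsFiniteMeasure μ] (T : X ≃ₜ X)
    (hT : MeasurePreserving T μ μ) : topFullGroup T →* l1FullGroup (homeoMP T hT) where
  toFun U := ⟨QuotientGroup.mk (homeoMP U (measurePreserving_of_mem T hT U.2)),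
    Subgroup.mem_map_of_mem (QuotientGroup.mk' (aeTrivial μ)) (by
      refine ⟨Eventually.of_forall fun x => ?_, ?_⟩
      · obtain ⟨n, hn⟩ := U.2 x
        exact ⟨n, (toEquiv_zpow T n x).trans hn.self_of_nhds.symm⟩
      · obtain ⟨C, hC⟩ := orbitDist_bdd_of_mem T U.2
        refine (lintegral_mono (g := fun _ => (C : ℝ≥0∞)) hC).trans_lt ?_
        rw [lintegral_const]
        exact ENNReal.mul_lt_top (ENNReal.natCast_lt_top C) (measure_lt_top μ _))⟩
  map_one' := rfl
  map_mul' _ _ := rfl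

end Topological

end L1FullGroup

namespace L1FullGroup

/-! ### The `L¹` full group is a topological group -/

section TopologicalGroup

/-! The metric makes `[T]₁` a topological group, so the statement on derived subgroups follows
formally from density of `[T]_c` (`closure_image_commutator`). It remains to show that the closure
`G` of the image of `[T]_c`, which is a closed subgroup, contains every `S` in `[T]₁`.

The building blocks are the maps that permute the levels `T ^ i '' A` of a finite tower. Over a
clopen base they lie in `[T]_c`. Over a measurable base they are limits of such maps, hence lie in
`G` (`towerMP_mem_closed`).

Suppose first that for every `b` in a set `B` of positive measure, `S` preserves both the negative
and the nonnegative half of the orbit of `b`. By recurrence and aperiodicity, `B` cuts almost every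
orbit into finite segments, and `S` permutes each of them. So `S` is a countable product of tower
permutations with disjoint supports, and integrability makes the finite subproducts approximate `S`
(`l1mk_mem_closed_of_sideSet`).

A general `S` is reduced to this case. Since `x ↦ d_T (x, S x)` is integrable, Borel–Cantelli shows
that on almost every orbit only finitely many points are moved across the origin
(`ae_finite_natAbs_le_orbitDist`). A permutation of a finite window and a shift `T ^ k` undo these
crossings. There are countably many such corrections, so one of them works on a set of positive
measure. On a subset `B` with long return times the windows are disjoint, and the corrections
combine into a tower permutation `V`. Then `S * V * T ^ k` is of the first kind
(`subset_sideSet_mul`), while `V` and `T ^ k` belong to `G`. -/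

theorem one_le_orbitDist {X : Type*} (T : Equiv.Perm X) {x y : X} (h : x ≠ y) :
    1 ≤ orbitDist T x y := by
  refine le_iInf₂ fun n hn => ?_
  have : n ≠ 0 := by
    rintro rfl
    exact h (by simpa using hn)
  exact_mod_cast Int.natAbs_pos.2 this

variable {X : Type*} [MeasurableSpace X] [StandardBorelSpace X] {μ : Measure X}

theorem measure_ne_le_preEDist (T f g : mpPerm μ) :
    μ {x | (f : Equiv.Perm X) x ≠ (g : Equiv.Perm X) x} ≤ preEDist T f g := by
  have hm : MeasurableSet {x | (f : Equiv.Perm X) x ≠ (g : Equiv.Perm X) x} :=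
    (measurableSet_eq_fun f.2.1.measurable g.2.1.measurable).compl
  rw [← lintegral_indicator_one hm]
  refine lintegral_mono fun x => ?_
  by_cases hx : (f : Equiv.Perm X) x = (g : Equiv.Perm X) x
  · simp [hx]
  · exact Set.indicator_le_self' (fun _ _ => zero_le) x |>.trans (one_le_orbitDist _ hx)

omit [StandardBorelSpace X] in
theorem setLIntegral_comp_perm (g : mpPerm μ) {u : X → ℝ≥0∞} (hu : Measurable u) {A : Set X}
    (hA : MeasurableSet A) :
    ∫⁻ x in A, u ((g : Equiv.Perm X) x) ∂μ = ∫⁻ x in (g : Equiv.Perm X).symm ⁻¹' A, u x ∂μ := by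
  rw [← g.2.1.setLIntegral_comp_preimage (g.2.2.measurable hA) hu]
  congr 2
  ext x
  simp

/-- Left multiplication by an element of `[T]₁` is continuous for `d̃_T`. -/
theorem exists_preEDist_mul_left_lt (T : mpPerm μ) {f : mpPerm μ} (hf : f ∈ preL1 T)
    {ε : ℝ≥0∞} (hε : 0 < ε) :
    ∃ δ > 0, ∀ g h : mpPerm μ, preEDist T g h < δ → preEDist T (f * g) (f * h) < ε := by
  have hε3 : ε / 3 ≠ 0 := (ENNReal.div_pos hε.ne' (by simp)).ne'
  obtain ⟨δ, hδ, H⟩ := exists_pos_setLIntegral_lt_of_measure_lt hf.2.ne hε3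
  refine ⟨min δ (ε / 3), lt_min hδ (pos_iff_ne_zero.2 hε3), fun g h hgh => ?_⟩
  let A : Set X := {x | (g : Equiv.Perm X) x ≠ (h : Equiv.Perm X) x}
  have hA : MeasurableSet A := (measurableSet_eq_fun g.2.1.measurable h.2.1.measurable).compl
  have hμA : μ A < δ :=
    (measure_ne_le_preEDist T g h).trans_lt (hgh.trans_le (min_le_left _ _))
  let u : X → ℝ≥0∞ := fun y => orbitDist (T : Equiv.Perm X) y ((f : Equiv.Perm X) y)
  have hu : Measurable u := measurable_orbitDist T 1 f
  -- Integrating `u ∘ k` over `A` amounts to integrating `u` over the image of `A` under `k`, which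
  -- has the same small measure, so absolute continuity of the integral applies.
  have key : ∀ k : mpPerm μ, ∫⁻ x in A, u ((k : Equiv.Perm X) x) ∂μ < ε / 3 := fun k => by
    rw [setLIntegral_comp_perm k hu hA]
    exact H _ (by rwa [k.2.2.measure_preimage hA.nullMeasurableSet])
  -- Off `A` the left side vanishes. On `A`, go from `f (g x)` to `f (h x)` through `g x` and `h x`.
  have hpt : ∀ x, orbitDist (T : Equiv.Perm X) ((f * g : mpPerm μ).1 x) ((f * h : mpPerm μ).1 x) ≤
      A.indicator (fun x => u ((g : Equiv.Perm X) x)) x +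
        (orbitDist (T : Equiv.Perm X) ((g : Equiv.Perm X) x) ((h : Equiv.Perm X) x) +
          A.indicator (fun x => u ((h : Equiv.Perm X) x)) x) := fun x => by
    change orbitDist (T : Equiv.Perm X) ((f : Equiv.Perm X) ((g : Equiv.Perm X) x))
      ((f : Equiv.Perm X) ((h : Equiv.Perm X) x)) ≤ _
    by_cases hx : x ∈ A
    · rw [Set.indicator_of_mem hx, Set.indicator_of_mem hx]
      refine (orbitDist_triangle _ _ ((g : Equiv.Perm X) x) _).trans (add_le_add ?_ ?_)
      · rw [orbitDist_comm]
      · exact orbitDist_triangle _ _ ((h : Equiv.Perm X) x) _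
    · have hx' : (g : Equiv.Perm X) x = (h : Equiv.Perm X) x := not_not.1 hx
      rw [hx', orbitDist_self]
      exact zero_le
  calc preEDist T (f * g) (f * h)
      ≤ ∫⁻ x, A.indicator (fun x => u ((g : Equiv.Perm X) x)) x +
        (orbitDist (T : Equiv.Perm X) ((g : Equiv.Perm X) x) ((h : Equiv.Perm X) x) +
          A.indicator (fun x => u ((h : Equiv.Perm X) x)) x) ∂μ := lintegral_mono hpt
    _ = ∫⁻ x in A, u ((g : Equiv.Perm X) x) ∂μ + (preEDist T g h +
          ∫⁻ x in A, u ((h : Equiv.Perm X) x) ∂μ) := by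
        have hug : Measurable fun x => u ((g : Equiv.Perm X) x) := hu.comp g.2.1.measurable
        rw [lintegral_add_left (hug.indicator hA),
          lintegral_add_left (measurable_orbitDist T g h), lintegral_indicator hA,
          lintegral_indicator hA]
        rfl
    _ < ε / 3 + (ε / 3 + ε / 3) := by
        exact ENNReal.add_lt_add (key g) (ENNReal.add_lt_add
          (hgh.trans_le (min_le_right _ _)) (key h))
    _ = ε := by rw [← add_assoc, ENNReal.add_thirds]

theorem edist_mul_right_eq (T : mpPerm μ) (f g h : l1FullGroup T) :
    edist (f * h) (g * h) = edist f g := by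
  obtain ⟨_, f, _, rfl⟩ := f
  obtain ⟨_, g, _, rfl⟩ := g
  obtain ⟨_, h, _, rfl⟩ := h
  exact preEDist_mul_right T f g h

theorem exists_edist_mul_left_lt (T : mpPerm μ) (f : l1FullGroup T) {ε : ℝ≥0∞} (hε : 0 < ε) :
    ∃ δ > 0, ∀ g h : l1FullGroup T, edist g h < δ → edist (f * g) (f * h) < ε := by
  obtain ⟨_, f, hf, rfl⟩ := f
  obtain ⟨δ, hδ, H⟩ := exists_preEDist_mul_left_lt T hf hε
  refine ⟨δ, hδ, ?_⟩
  rintro ⟨_, g, hg, rfl⟩ ⟨_, h, hh, rfl⟩ hgh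
  exact H g h hgh

theorem continuous_mul_left_l1 (T : mpPerm μ) (f : l1FullGroup T) :
    Continuous fun g => f * g :=
  EMetric.continuous_iff.2 fun g ε hε => by
    obtain ⟨δ, hδ, H⟩ := exists_edist_mul_left_lt T f hε
    exact ⟨δ, hδ, fun h hh => H h g hh⟩

/-- Right invariance of the metric upgrades continuity of left translations to joint continuity of
the product. It also turns the distance from `g⁻¹` to `f⁻¹` into that from `f⁻¹ * g` to `1`. -/
instance (T : mpPerm μ) : IsTopologicalGroup (l1FullGroup T) where
  continuous_mul := by
    refine continuous_iff_continuousAt.2 fun ⟨f, g⟩ => ?_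
    refine tendsto_iff_edist_tendsto_0.2 ?_
    have h1 : Tendsto (fun p : l1FullGroup T × l1FullGroup T => edist p.1 f) (𝓝 (f, g)) (𝓝 0) :=
      tendsto_iff_edist_tendsto_0.1 (continuous_fst.tendsto (f, g))
    have h2 : Tendsto (fun p : l1FullGroup T × l1FullGroup T => edist (f * p.2) (f * g))
        (𝓝 (f, g)) (𝓝 0) :=
      tendsto_iff_edist_tendsto_0.1
        (((continuous_mul_left_l1 T f).comp continuous_snd).tendsto (f, g))
    have h3 := h1.add h2
    rw [add_zero] at h3
    refine tendsto_of_tendsto_of_tendsto_of_le_of_le tendsto_const_nhds h3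
      (fun _ => zero_le) fun p => ?_
    refine (edist_triangle _ (f * p.2) _).trans_eq ?_
    rw [edist_mul_right_eq]
  continuous_inv := by
    refine continuous_iff_continuousAt.2 fun f => tendsto_iff_edist_tendsto_0.2 ?_
    have h2 : Tendsto (fun g : l1FullGroup T => edist (f⁻¹ * g) (f⁻¹ * f)) (𝓝 f) (𝓝 0) :=
      tendsto_iff_edist_tendsto_0.1 ((continuous_mul_left_l1 T f⁻¹).tendsto f)
    refine h2.congr fun g => ?_
    rw [← edist_mul_right_eq T g⁻¹ f⁻¹ g, inv_mul_cancel, inv_mul_cancel, edist_comm]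

end TopologicalGroup

/-- The image of the derived subgroup of a group is dense in the derived subgroup of a topological
group in which the image of the group is dense. -/
theorem closure_image_commutator {G H : Type*} [Group G] [Group H] [TopologicalSpace H]
    [IsTopologicalGroup H] (φ : G →* H) (hφ : DenseRange φ) :
    closure (φ '' (commutator G : Set G)) = closure (commutator H : Set H) := by
  refine subset_antisymm (closure_mono ?_) (closure_minimal ?_ isClosed_closure)
  · rintro _ ⟨g, hg, rfl⟩
    have h : (commutator G).map φ ≤ commutator H := by
      rw [commutator_def, commutator_def, Subgroup.map_commutator]
      exact Subgroup.commutator_mono le_top le_top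
    exact h (Subgroup.mem_map_of_mem φ hg)
  -- The closure is a subgroup, so only single commutators need to be approximated.
  · have h : commutator H ≤ ((commutator G).map φ).topologicalClosure := by
      rw [commutator_def H, Subgroup.commutator_le]
      rintro a - b -
      have hc : Continuous fun p : H × H => p.1 * p.2 * p.1⁻¹ * p.2⁻¹ := by fun_prop
      have hab : (a, b) ∈ closure (Set.range φ ×ˢ Set.range φ) := by
        rw [closure_prod_eq]
        exact ⟨hφ a, hφ b⟩
      refine map_mem_closure (f := fun p : H × H => p.1 * p.2 * p.1⁻¹ * p.2⁻¹) hc hab ?_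
      rintro ⟨_, _⟩ ⟨⟨x, rfl⟩, ⟨y, rfl⟩⟩
      refine ⟨x * y * x⁻¹ * y⁻¹, ?_, by simp⟩
      exact Subgroup.commutator_mem_commutator (Subgroup.mem_top x) (Subgroup.mem_top y)
    exact h

/-! ### Permuting the levels of a tower -/

section Tower

variable {X : Type*} {T : Equiv.Perm X} {W : Finset ℤ} {σ : Equiv.Perm ℤ} {A : Set X}

/-- The sets `T ^ i '' A`, `i ∈ W`, are pairwise disjoint. -/
def IsTower (T : Equiv.Perm X) (W : Finset ℤ) (A : Set X) : Prop :=
  ∀ i ∈ W, ∀ j ∈ W, ∀ a ∈ A, ∀ b ∈ A, (T ^ i) a = (T ^ j) b → i = j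

/-- The exponent of the power of `T` which `towerPerm` applies to `x`. -/
noncomputable def towerShift (T : Equiv.Perm X) (W : Finset ℤ) (σ : Equiv.Perm ℤ) (A : Set X)
    (x : X) : ℤ :=
  ∑ i ∈ W, ((T ^ (-i)) ⁻¹' A).indicator (fun _ => σ i - i) x

theorem zpow_neg_apply_eq_iff (T : Equiv.Perm X) (i : ℤ) (x y : X) :
    (T ^ (-i)) x = y ↔ (T ^ i) y = x := by
  rw [zpow_neg, Equiv.Perm.inv_eq_iff_eq, eq_comm]

theorem zpow_sub_apply_zpow (T : Equiv.Perm X) (i j : ℤ) (x : X) :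
    (T ^ (j - i)) ((T ^ i) x) = (T ^ j) x := by
  rw [← Equiv.Perm.mul_apply, ← zpow_add, sub_add_cancel]

theorem towerShift_zpow_apply (h : IsTower T W A) {i : ℤ} (hi : i ∈ W) {a : X} (ha : a ∈ A) :
    towerShift T W σ A ((T ^ i) a) = σ i - i := by
  unfold towerShift
  rw [Finset.sum_eq_single_of_mem i hi, Set.indicator_of_mem]
  · change (T ^ (-i)) ((T ^ i) a) ∈ A
    rwa [(zpow_neg_apply_eq_iff T i _ _).2 rfl]
  · intro j hj hji
    refine Set.indicator_of_notMem (fun hmem => hji ?_) _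
    refine h j hj i hi _ hmem a ha ?_
    rw [← zpow_neg_apply_eq_iff]

theorem towerShift_eq_zero {x : X} (hx : ∀ i ∈ W, ∀ a ∈ A, (T ^ i) a ≠ x) :
    towerShift T W σ A x = 0 :=
  Finset.sum_eq_zero fun i hi => Set.indicator_of_notMem (s := (T ^ (-i)) ⁻¹' A)
    (fun hmem => hx i hi _ hmem ((zpow_neg_apply_eq_iff T i _ _).1 rfl)) _

theorem natAbs_towerShift_le (x : X) :
    (towerShift T W σ A x).natAbs ≤ ∑ i ∈ W, (σ i - i).natAbs := by
  refine (Int.natAbs_sum_le _ _).trans (Finset.sum_le_sum fun i _ => ?_)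
  by_cases hx : x ∈ (T ^ (-i)) ⁻¹' A
  · rw [Set.indicator_of_mem hx]
  · rw [Set.indicator_of_notMem hx]
    exact Nat.zero_le _

/-- The shift is a sum of indicators, so two bases can be compared term by term, without assuming
that either gives a tower. -/
theorem natAbs_towerShift_sub_le (A' : Set X) (x : X) :
    ((towerShift T W σ A' x - towerShift T W σ A x).natAbs : ℝ≥0∞) ≤
      ∑ i ∈ W, ((T ^ (-i)) ⁻¹' symmDiff A A').indicator
        (fun _ => ((σ i - i).natAbs : ℝ≥0∞)) x := by
  classical
  unfold towerShift
  rw [← Finset.sum_sub_distrib]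
  refine (Nat.cast_le.2 (Int.natAbs_sum_le _ _)).trans ?_
  rw [Nat.cast_sum]
  refine Finset.sum_le_sum fun i _ => ?_
  by_cases h1 : (T ^ (-i)) x ∈ A <;> by_cases h2 : (T ^ (-i)) x ∈ A' <;>
    simp only [Set.indicator_apply, Set.mem_preimage, Set.mem_symmDiff, h1, h2, not_true_eq_false,
      not_false_eq_true, and_true, and_false, or_false, or_true, if_true, if_false, sub_self,
      sub_zero, zero_sub, Int.natAbs_neg, Int.natAbs_zero, Nat.cast_zero, le_refl]

/-- The map which sends `T ^ i a` to `T ^ (σ i) a` for `a ∈ A` and `i ∈ W`, and which fixes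
all other points. -/
noncomputable def towerMap (T : Equiv.Perm X) (W : Finset ℤ) (σ : Equiv.Perm ℤ) (A : Set X)
    (x : X) : X :=
  (T ^ towerShift T W σ A x) x

theorem towerMap_zpow_apply (h : IsTower T W A) {i : ℤ} (hi : i ∈ W) {a : X} (ha : a ∈ A) :
    towerMap T W σ A ((T ^ i) a) = (T ^ σ i) a := by
  rw [towerMap, towerShift_zpow_apply h hi ha, zpow_sub_apply_zpow]

theorem towerMap_eq_self {x : X} (hx : ∀ i ∈ W, ∀ a ∈ A, (T ^ i) a ≠ x) :
    towerMap T W σ A x = x := by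
  rw [towerMap, towerShift_eq_zero hx, zpow_zero, Equiv.Perm.one_apply]

theorem apply_mem_of_forall_notMem (hσ : ∀ i ∉ W, σ i = i) {i : ℤ} (hi : i ∈ W) : σ i ∈ W := by
  by_contra h
  exact h (by rwa [σ.injective (hσ _ h)])

theorem symm_apply_of_notMem (hσ : ∀ i ∉ W, σ i = i) (i : ℤ) (hi : i ∉ W) : σ.symm i = i := by
  rw [Equiv.symm_apply_eq, hσ i hi]

theorem towerMap_symm_towerMap (h : IsTower T W A) (hσ : ∀ i ∉ W, σ i = i) (x : X) :
    towerMap T W σ.symm A (towerMap T W σ A x) = x := by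
  by_cases hx : ∃ i ∈ W, ∃ a ∈ A, (T ^ i) a = x
  · obtain ⟨i, hi, a, ha, rfl⟩ := hx
    rw [towerMap_zpow_apply h hi ha, towerMap_zpow_apply h (apply_mem_of_forall_notMem hσ hi) ha,
      Equiv.symm_apply_apply]
  · push Not at hx
    rw [towerMap_eq_self hx, towerMap_eq_self hx]

/-- `towerMap` as a permutation. -/
noncomputable def towerPerm (h : IsTower T W A) (hσ : ∀ i ∉ W, σ i = i) : Equiv.Perm X where
  toFun := towerMap T W σ A
  invFun := towerMap T W σ.symm A
  left_inv := towerMap_symm_towerMap h hσ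
  right_inv := towerMap_symm_towerMap (σ := σ.symm) h (symm_apply_of_notMem hσ)

/-- Disjointness of the levels only excludes finitely many return times to the base. In this form it
can be enforced by shrinking the base. -/
theorem IsTower.of_forall_sub (hA : ∀ i ∈ W, ∀ j ∈ W, i ≠ j → ∀ a ∈ A, (T ^ (i - j)) a ∉ A) :
    IsTower T W A := by
  intro i hi j hj a ha b hb hab
  by_contra hij
  refine hA i hi j hj hij a ha ?_
  have : (T ^ (i - j)) a = b := by
    rw [sub_eq_neg_add, zpow_add, Equiv.Perm.mul_apply, hab, zpow_neg_apply_eq_iff]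
  rwa [this]

theorem IsTower.zpow_sub_notMem (h : IsTower T W A) {i j : ℤ} (hi : i ∈ W) (hj : j ∈ W)
    (hij : i ≠ j) {a : X} (ha : a ∈ A) : (T ^ (i - j)) a ∉ A := fun hmem => by
  refine hij (h i hi j hj a ha _ hmem ?_)
  rw [← Equiv.Perm.mul_apply, ← zpow_add, add_sub_cancel]

theorem orbitDist_zpow_zpow_le (T : Equiv.Perm X) (m n : ℤ) (x : X) :
    orbitDist T ((T ^ m) x) ((T ^ n) x) ≤ (n - m).natAbs :=
  orbitDist_le T (zpow_sub_apply_zpow T m n x)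

end Tower

/-! ### Tower permutations over clopen sets -/

section TowerTopological

variable {X : Type*} [TopologicalSpace X] {T : X ≃ₜ X} {W : Finset ℤ} {σ : Equiv.Perm ℤ}
  {A : Set X}

theorem continuous_toEquiv_zpow (T : X ≃ₜ X) (n : ℤ) : Continuous (T.toEquiv ^ n : Equiv.Perm X) :=
  (T ^ n).continuous.congr fun x => (toEquiv_zpow T n x).symm

theorem isLocallyConstant_towerShift (hA : IsClopen A) :
    IsLocallyConstant (towerShift T.toEquiv W σ A) := by
  refine IsLocallyConstant.iff_continuous _ |>.2 ?_
  unfold towerShift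
  refine continuous_finsetSum _ fun i _ => ?_
  -- A clopen set has empty frontier, so its indicator is continuous.
  exact continuous_const.indicator fun x hx => by
    rw [(hA.preimage (continuous_toEquiv_zpow T (-i))).frontier_eq] at hx
    exact hx.elim

theorem eventually_towerMap_eq (hA : IsClopen A) (x : X) :
    ∀ᶠ y in 𝓝 x, towerMap T.toEquiv W σ A y = (T ^ towerShift T.toEquiv W σ A x) y := by
  filter_upwards [((isLocallyConstant_towerShift hA).eventually_eq x)] with y hy
  rw [towerMap, hy, toEquiv_zpow]

theorem continuous_towerMap (hA : IsClopen A) : Continuous (towerMap T.toEquiv W σ A) :=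
  continuous_iff_continuousAt.2 fun x =>
    (T ^ towerShift T.toEquiv W σ A x).continuous.continuousAt.congr
      ((eventually_towerMap_eq hA x).mono fun _ h => h.symm)

/-- `towerPerm` over a clopen set, as a homeomorphism. -/
noncomputable def towerHomeo (hA : IsClopen A) (h : IsTower T.toEquiv W A)
    (hσ : ∀ i ∉ W, σ i = i) : X ≃ₜ X where
  toEquiv := towerPerm h hσ
  continuous_toFun := continuous_towerMap hA
  continuous_invFun := continuous_towerMap (σ := σ.symm) hA

theorem towerHomeo_mem (hA : IsClopen A) (h : IsTower T.toEquiv W A) (hσ : ∀ i ∉ W, σ i = i) :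
    towerHomeo hA h hσ ∈ topFullGroup T :=
  fun x => ⟨_, eventually_towerMap_eq hA x⟩

end TowerTopological

/-! ### Tower permutations over measurable sets -/

section TowerMeasured

variable {X : Type*} [MeasurableSpace X] {μ : Measure X}

theorem measurable_zpow (T : mpPerm μ) (n : ℤ) :
    Measurable ((T : Equiv.Perm X) ^ n : Equiv.Perm X) :=
  (T ^ n).2.1.measurable

theorem measurePreserving_zpow (T : mpPerm μ) (n : ℤ) :
    MeasurePreserving ((T : Equiv.Perm X) ^ n : Equiv.Perm X) μ μ :=
  (T ^ n).2.1

theorem measurable_zpow_apply (T : mpPerm μ) {m : X → ℤ} (hm : Measurable m) :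
    Measurable fun x => ((T : Equiv.Perm X) ^ m x) x := by
  intro B hB
  have : (fun x => ((T : Equiv.Perm X) ^ m x) x) ⁻¹' B =
      ⋃ n : ℤ, m ⁻¹' {n} ∩ ((T : Equiv.Perm X) ^ n : Equiv.Perm X) ⁻¹' B := by
    ext x
    simp
  rw [this]
  exact MeasurableSet.iUnion fun n =>
    (hm (measurableSet_singleton n)).inter (measurable_zpow T n hB)

theorem measurable_towerShift (T : mpPerm μ) (W : Finset ℤ) (σ : Equiv.Perm ℤ) {A : Set X}
    (hA : MeasurableSet A) : Measurable (towerShift (T : Equiv.Perm X) W σ A) := by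
  unfold towerShift
  exact Finset.measurable_fun_sum _ fun i _ =>
    measurable_const.indicator (measurable_zpow T (-i) hA)

theorem measurable_towerMap (T : mpPerm μ) (W : Finset ℤ) (σ : Equiv.Perm ℤ) {A : Set X}
    (hA : MeasurableSet A) : Measurable (towerMap (T : Equiv.Perm X) W σ A) :=
  measurable_zpow_apply T (measurable_towerShift T W σ hA)

/-- A measurable bijection which moves each point inside its `T`-orbit preserves every measure
which `T` preserves. -/
theorem measurePreserving_of_zpow (T : mpPerm μ) {f : Equiv.Perm X} {m : X → ℤ}
    (hm : Measurable m) (hf : Measurable f.symm)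
    (h : ∀ x, f x = ((T : Equiv.Perm X) ^ m x) x) : MeasurePreserving f μ μ := by
  have hfm : Measurable f := by
    rw [show (f : X → X) = fun x => ((T : Equiv.Perm X) ^ m x) x from funext h]
    exact measurable_zpow_apply T hm
  refine ⟨hfm, ?_⟩
  let e : ℤ ≃ ℕ := Equiv.intEquivNat
  have hA : ∀ n, MeasurableSet (m ⁻¹' {n}) := fun n => hm (measurableSet_singleton n)
  have hAd : Pairwise (Function.onFun Disjoint fun n => m ⁻¹' {n}) := fun i j hij =>
    Disjoint.preimage _ (by simpa using hij)
  have hAu : ⋃ n, m ⁻¹' {n} = Set.univ := by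
    ext x
    simp
  ext B hB
  have hImg : ∀ n, MeasurableSet (f '' (m ⁻¹' {n})) := fun n => by
    rw [f.image_eq_preimage_symm]
    exact hf (hA n)
  calc Measure.map f μ B = μ (⋃ n, f ⁻¹' B ∩ m ⁻¹' {n}) := by
        rw [Measure.map_apply hfm hB, ← Set.inter_iUnion, hAu, Set.inter_univ]
    _ = ∑' n, μ (f ⁻¹' B ∩ m ⁻¹' {n}) :=
        measure_iUnion (fun i j hij => (hAd hij).mono Set.inter_subset_right Set.inter_subset_right)
          fun n => (hfm hB).inter (hA n)
    _ = ∑' n, μ (B ∩ f '' (m ⁻¹' {n})) := by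
        refine tsum_congr fun n => ?_
        rw [← (measurePreserving_zpow T n).measure_preimage (hB.inter (hImg n)).nullMeasurableSet]
        congr 1
        ext x
        constructor
        · rintro ⟨h1, rfl⟩
          rw [Set.mem_preimage, ← h x]
          exact ⟨h1, x, rfl, rfl⟩
        · rintro ⟨h1, y, rfl, h2⟩
          rw [h y] at h2
          obtain rfl := ((T : Equiv.Perm X) ^ m y).injective h2
          refine ⟨?_, rfl⟩
          rw [Set.mem_preimage, h y]
          exact h1
    _ = μ (⋃ n, B ∩ f '' (m ⁻¹' {n})) := by
        refine (measure_iUnion (fun i j hij => ?_) fun n => hB.inter (hImg n)).symm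
        exact ((Set.disjoint_image_iff f.injective).2 (hAd hij)).mono
          Set.inter_subset_right Set.inter_subset_right
    _ = μ B := by
        rw [← Set.inter_iUnion, ← Set.image_iUnion, hAu, Set.image_univ, f.surjective.range_eq,
          Set.inter_univ]

variable {T : mpPerm μ} {W : Finset ℤ} {σ : Equiv.Perm ℤ} {A : Set X}

/-- `towerPerm` over a measurable set, as a measure-preserving bijection. -/
noncomputable def towerMP (hA : MeasurableSet A) (h : IsTower (T : Equiv.Perm X) W A)
    (hσ : ∀ i ∉ W, σ i = i) : mpPerm μ :=
  ⟨towerPerm h hσ,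
    measurePreserving_of_zpow T (measurable_towerShift T W σ hA)
      (measurable_towerMap T W σ.symm hA) fun _ => rfl,
    measurePreserving_of_zpow T (f := (towerPerm h hσ).symm) (measurable_towerShift T W σ.symm hA)
      (measurable_towerMap T W σ hA) fun _ => rfl⟩

theorem towerMP_mem_preL1 [StandardBorelSpace X] [IsFiniteMeasure μ] (hA : MeasurableSet A)
    (h : IsTower (T : Equiv.Perm X) W A) (hσ : ∀ i ∉ W, σ i = i) :
    towerMP hA h hσ ∈ preL1 T := by
  refine ⟨Eventually.of_forall fun x => ⟨_, rfl⟩, ?_⟩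
  have hle : ∀ x, orbitDist (T : Equiv.Perm X) x ((towerMP hA h hσ : Equiv.Perm X) x) ≤
      ((∑ i ∈ W, (σ i - i).natAbs : ℕ) : ℝ≥0∞) := fun x =>
    (orbitDist_le _ rfl).trans (Nat.cast_le.2 (natAbs_towerShift_le x))
  refine (lintegral_mono hle).trans_lt ?_
  rw [lintegral_const]
  exact ENNReal.mul_lt_top (ENNReal.natCast_lt_top _) (measure_lt_top μ _)

/-- Both images of `x` are powers of `T` applied to `x`, so their distance is at most the difference
of the exponents. The factor depends on `W` and `σ` only, which makes the tower permutation
continuous in its base. -/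
theorem preEDist_towerMP_le [StandardBorelSpace X] {A' : Set X} (hA : MeasurableSet A)
    (hA' : MeasurableSet A') (h : IsTower (T : Equiv.Perm X) W A)
    (h' : IsTower (T : Equiv.Perm X) W A') (hσ : ∀ i ∉ W, σ i = i) :
    preEDist T (towerMP hA h hσ) (towerMP hA' h' hσ) ≤
      (∑ i ∈ W, ((σ i - i).natAbs : ℝ≥0∞)) * μ (symmDiff A A') := by
  have hm : MeasurableSet (symmDiff A A') := hA.symmDiff hA'
  calc preEDist T (towerMP hA h hσ) (towerMP hA' h' hσ)
      ≤ ∫⁻ x, ∑ i ∈ W, (((T : Equiv.Perm X) ^ (-i)) ⁻¹' symmDiff A A').indicator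
        (fun _ => ((σ i - i).natAbs : ℝ≥0∞)) x ∂μ :=
        lintegral_mono fun x => (orbitDist_zpow_zpow_le _ _ _ _).trans
          (natAbs_towerShift_sub_le A' x)
    _ = _ := by
        rw [lintegral_finsetSum _ fun i _ =>
          measurable_const.indicator (measurable_zpow T (-i) hm), Finset.sum_mul]
        refine Finset.sum_congr rfl fun i _ => ?_
        rw [lintegral_indicator_const (measurable_zpow T (-i) hm),
          (measurePreserving_zpow T (-i)).measure_preimage hm.nullMeasurableSet]

end TowerMeasured

/-! ### Classes in the `L¹` full group -/

section Mk

variable {X : Type*} [MeasurableSpace X] [StandardBorelSpace X] {μ : Measure X}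

/-- The class in `[T]₁` of an element of `preL1 T`. -/
noncomputable def l1mk (T : mpPerm μ) (f : mpPerm μ) (hf : f ∈ preL1 T) : l1FullGroup T :=
  ⟨QuotientGroup.mk f, Subgroup.mem_map_of_mem (QuotientGroup.mk' (aeTrivial μ)) hf⟩

theorem edist_l1mk (T : mpPerm μ) {f g : mpPerm μ} (hf : f ∈ preL1 T) (hg : g ∈ preL1 T) :
    edist (l1mk T f hf) (l1mk T g hg) = preEDist T f g := rfl

theorem l1mk_mul (T : mpPerm μ) {f g : mpPerm μ} (hf : f ∈ preL1 T) (hg : g ∈ preL1 T) :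
    l1mk T (f * g) (mul_mem hf hg) = l1mk T f hf * l1mk T g hg := rfl

end Mk

theorem self_mem_topFullGroup {Y : Type*} [TopologicalSpace Y] (T : Y ≃ₜ Y) :
    T ∈ topFullGroup T :=
  fun _ => ⟨1, by simp⟩

/-! ### The closure of the topological full group -/

section Closure

variable {X : Type*} [TopologicalSpace X] [PolishSpace X] [MeasurableSpace X] [BorelSpace X]
  {μ : Measure X} [IsFiniteMeasure μ] (T : X ≃ₜ X) (hT : MeasurePreserving T μ μ)

theorem homeoMP_mem_preL1 : homeoMP T hT ∈ preL1 (homeoMP T hT) := by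
  refine ⟨Eventually.of_forall fun x => ⟨1, by simp⟩, ?_⟩
  have hle : ∀ x, orbitDist (homeoMP T hT : Equiv.Perm X) x ((homeoMP T hT : Equiv.Perm X) x) ≤ 1 :=
    fun x => (orbitDist_le (n := 1) _ (by simp)).trans (by simp)
  refine (lintegral_mono hle).trans_lt ?_
  rw [lintegral_const]
  exact ENNReal.mul_lt_top ENNReal.one_lt_top (measure_lt_top μ _)

variable [CompactSpace X]

/-- The closure in `[T]₁` of the image of `[T]_c`. -/
noncomputable def closedTopFullGroup : Subgroup (l1FullGroup (homeoMP T hT)) :=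
  (topToL1 T hT).range.topologicalClosure

theorem mem_closedTopFullGroup_iff {f : l1FullGroup (homeoMP T hT)} :
    f ∈ closedTopFullGroup T hT ↔ ∀ ε > 0, ∃ g ∈ closedTopFullGroup T hT, edist f g < ε := by
  refine ⟨fun h ε hε => ⟨f, h, by simpa using hε⟩, fun h => ?_⟩
  have hc : IsClosed (closedTopFullGroup T hT : Set (l1FullGroup (homeoMP T hT))) :=
    Subgroup.isClosed_topologicalClosure _
  rw [← SetLike.mem_coe, ← hc.closure_eq]
  exact EMetric.mem_closure_iff.2 h

theorem topToL1_mem (U : topFullGroup T) : topToL1 T hT U ∈ closedTopFullGroup T hT :=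
  Subgroup.le_topologicalClosure _ ⟨U, rfl⟩

theorem homeoMP_mem_closed :
    l1mk (homeoMP T hT) (homeoMP T hT) (homeoMP_mem_preL1 T hT) ∈ closedTopFullGroup T hT :=
  topToL1_mem T hT ⟨T, self_mem_topFullGroup T⟩

end Closure

/-! ### Approximation of measurable towers by clopen ones -/

section Approximation

variable {X : Type*} [TopologicalSpace X] [CompactSpace X] [TotallyDisconnectedSpace X]
  [PolishSpace X] [MeasurableSpace X] [BorelSpace X] {μ : Measure X} [IsFiniteMeasure μ]

/-- Regularity squeezes `A` between a closed and an open set of nearly equal measure, and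
zero-dimensionality provides a clopen set in between. -/
theorem exists_isClopen_measure_symmDiff_lt {A : Set X} (hA : MeasurableSet A) {ε : ℝ≥0∞}
    (hε : ε ≠ 0) : ∃ C, IsClopen C ∧ μ (symmDiff A C) < ε := by
  have hε2 : ε / 2 ≠ 0 := (ENNReal.half_pos hε).ne'
  obtain ⟨K, hKA, hK, hμK⟩ := hA.exists_isClosed_sdiff_lt (measure_ne_top μ A) hε2
  obtain ⟨U, hAU, hU, -, hμU⟩ := hA.exists_isOpen_sdiff_lt (measure_ne_top μ A) hε2
  obtain ⟨C, hC, hKC, hCU⟩ := exists_clopen_of_closed_subset_open hK hU (hKA.trans hAU)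
  refine ⟨C, hC, ?_⟩
  calc μ (symmDiff A C) ≤ μ ((A \ K) ∪ (U \ A)) := by
        refine measure_mono ?_
        rintro x (⟨h1, h2⟩ | ⟨h1, h2⟩)
        · exact Or.inl ⟨h1, fun h => h2 (hKC h)⟩
        · exact Or.inr ⟨hCU h1, h2⟩
    _ ≤ μ (A \ K) + μ (U \ A) := measure_union_le _ _
    _ < ε / 2 + ε / 2 := ENNReal.add_lt_add hμK hμU
    _ = ε := ENNReal.add_halves ε

/-- A clopen approximation `C` of `A` need not be the base of a tower, so the points that return to
`C` at a nonzero difference `d` of elements of `W` are removed. Since `A` has no such returns, a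
removed point of `A` has its `d`-th iterate in `C \ A`. The error is thus multiplied by at most the
number of differences plus one. -/
theorem exists_isClopen_isTower (T : X ≃ₜ X) (hT : MeasurePreserving T μ μ) {W : Finset ℤ}
    {A : Set X} (hA : MeasurableSet A)
    (hW : IsTower T.toEquiv W A) {ε : ℝ≥0∞} (hε : ε ≠ 0) :
    ∃ C, IsClopen C ∧ IsTower T.toEquiv W C ∧ μ (symmDiff A C) < ε := by
  classical
  let D : Finset ℤ := ((W ×ˢ W).image fun p => p.1 - p.2).erase 0
  have hD : ∀ d ∈ D, ∀ a ∈ A, (T.toEquiv ^ d) a ∉ A := by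
    intro d hd a ha
    obtain ⟨hd0, hd⟩ := Finset.mem_erase.1 hd
    obtain ⟨⟨i, j⟩, hp, rfl⟩ := Finset.mem_image.1 hd
    obtain ⟨hi, hj⟩ := Finset.mem_product.1 hp
    exact hW.zpow_sub_notMem hi hj (fun h => hd0 (sub_eq_zero.2 h)) ha
  have hN : ((D.card + 1 : ℕ) : ℝ≥0∞) ≠ ∞ := ENNReal.natCast_ne_top _
  obtain ⟨C, hC, hμC⟩ := exists_isClopen_measure_symmDiff_lt (μ := μ) hA
    (ENNReal.div_pos hε hN).ne'
  let C' : Set X := C \ ⋃ d ∈ D, (T.toEquiv ^ d : Equiv.Perm X) ⁻¹' C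
  refine ⟨C', ?_, ?_, ?_⟩
  · exact hC.diff (Set.Finite.isClopen_biUnion D.finite_toSet fun d _ =>
      hC.preimage (continuous_toEquiv_zpow T d))
  · refine IsTower.of_forall_sub fun i hi j hj hij a ha hmem => ?_
    refine ha.2 (Set.mem_biUnion (x := i - j) ?_ hmem.1)
    exact Finset.mem_coe.2 (Finset.mem_erase.2 ⟨sub_ne_zero.2 hij,
      Finset.mem_image.2 ⟨(i, j), Finset.mem_product.2 ⟨hi, hj⟩, rfl⟩⟩)
  · have hm : MeasurableSet (symmDiff A C) := hA.symmDiff hC.isOpen.measurableSet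
    have hsub : symmDiff A C' ⊆
        symmDiff A C ∪ ⋃ d ∈ D, (T.toEquiv ^ d : Equiv.Perm X) ⁻¹' symmDiff A C := by
      rintro x (⟨hxA, hxC⟩ | ⟨hxC, hxA⟩)
      · by_cases hx : x ∈ C
        · obtain ⟨d, hd, hdx⟩ : ∃ d ∈ D, (T.toEquiv ^ d) x ∈ C := by
            by_contra hcon
            push Not at hcon
            exact hxC ⟨hx, by simpa using hcon⟩
          exact Or.inr (Set.mem_biUnion (x := d) hd (Or.inr ⟨hdx, hD d hd x hxA⟩))
        · exact Or.inl (Or.inl ⟨hxA, hx⟩)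
      · exact Or.inl (Or.inr ⟨hxC.1, hxA⟩)
    calc μ (symmDiff A C')
        ≤ μ (symmDiff A C) + ∑ d ∈ D, μ ((T.toEquiv ^ d : Equiv.Perm X) ⁻¹' symmDiff A C) :=
          (measure_mono hsub).trans ((measure_union_le _ _).trans
            (add_le_add le_rfl (measure_biUnion_finset_le _ _)))
      _ = (D.card + 1 : ℕ) * μ (symmDiff A C) := by
          have hd : ∀ d ∈ D, μ ((T.toEquiv ^ d : Equiv.Perm X) ⁻¹' symmDiff A C) =
              μ (symmDiff A C) := fun d _ =>
            (measurePreserving_zpow (homeoMP T hT) d).measure_preimage hm.nullMeasurableSet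
          rw [Finset.sum_congr rfl hd, Finset.sum_const, nsmul_eq_mul]
          push_cast
          ring
      _ < ε := by
          rw [mul_comm]
          exact ENNReal.mul_lt_of_lt_div hμC

/-- Approximate the base by clopen towers, keeping `W` and `σ` fixed. The resulting maps lie in
`[T]_c` and converge. -/
theorem towerMP_mem_closed (T : X ≃ₜ X) (hT : MeasurePreserving T μ μ) {W : Finset ℤ}
    {σ : Equiv.Perm ℤ} {A : Set X} (hA : MeasurableSet A)
    (h : IsTower T.toEquiv W A) (hσ : ∀ i ∉ W, σ i = i) :
    l1mk (homeoMP T hT) (towerMP (T := homeoMP T hT) hA h hσ)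
      (towerMP_mem_preL1 (T := homeoMP T hT) hA h hσ) ∈ closedTopFullGroup T hT := by
  refine (mem_closedTopFullGroup_iff T hT).2 fun ε hε => ?_
  let N : ℕ := ∑ i ∈ W, (σ i - i).natAbs + 1
  obtain ⟨C, hC, hCW, hμC⟩ := exists_isClopen_isTower T hT hA h (ε := ε / N)
    (ENNReal.div_pos hε.ne' (ENNReal.natCast_ne_top _)).ne'
  refine ⟨_, topToL1_mem T hT ⟨towerHomeo hC hCW hσ, towerHomeo_mem hC hCW hσ⟩, ?_⟩
  refine (preEDist_towerMP_le (T := homeoMP T hT) hA hC.isOpen.measurableSet h hCW hσ).trans_lt ?_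
  refine (mul_le_mul_left (b := ∑ i ∈ W, ((σ i - i).natAbs : ℝ≥0∞)) (c := (N : ℝ≥0∞)) ?_
    _).trans_lt ?_
  · simp only [N, Nat.cast_add, Nat.cast_sum]
    exact le_self_add
  · rw [mul_comm]
    exact ENNReal.mul_lt_of_lt_div hμC

end Approximation

/-! ### Recurrence and the Borel–Cantelli argument -/

section Dynamics

variable {X : Type*} [MeasurableSpace X] {μ : Measure X} {T : mpPerm μ}

theorem ergodic_inv (hE : Ergodic (T : Equiv.Perm X) μ) :
    Ergodic ((T⁻¹ : mpPerm μ) : Equiv.Perm X) μ := by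
  let e : X ≃ᵐ X := ⟨T, T.2.1.measurable, T.2.2.measurable⟩
  exact Ergodic.symm (e := e) hE

variable [IsProbabilityMeasure μ]

/-- The set of points whose forward orbit meets `B` contains its own preimage, so by ergodicity it
is null or conull, and it contains `B`. -/
theorem ae_exists_pow_mem (hE : Ergodic (T : Equiv.Perm X) μ) {B : Set X} (hB : MeasurableSet B)
    (hμ : μ B ≠ 0) : ∀ᵐ x ∂μ, ∃ n : ℕ, ((T : Equiv.Perm X) ^ (n : ℤ)) x ∈ B := by
  let W : Set X := {x | ∃ n : ℕ, ((T : Equiv.Perm X) ^ (n : ℤ)) x ∈ B}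
  have hW : MeasurableSet W := by
    have : W = ⋃ n : ℕ, ((T : Equiv.Perm X) ^ (n : ℤ) : Equiv.Perm X) ⁻¹' B := by
      ext x
      simp [W]
    rw [this]
    exact MeasurableSet.iUnion fun n => measurable_zpow T n hB
  have hsub : (T : Equiv.Perm X) ⁻¹' W ⊆ W := by
    rintro x ⟨n, hn⟩
    refine ⟨n + 1, ?_⟩
    rw [Nat.cast_add, zpow_add, Nat.cast_one, zpow_one]
    exact hn
  rcases hE.ae_empty_or_univ_of_preimage_ae_le hW.nullMeasurableSet
    (Eventually.of_forall hsub) with h | h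
  · refine (hμ (measure_mono_null ?_ (ae_eq_empty.1 h))).elim
    exact fun x hx => ⟨0, by simpa using hx⟩
  · exact eventuallyEq_univ.1 h

theorem ae_exists_zpow_neg_mem (hE : Ergodic (T : Equiv.Perm X) μ) {B : Set X}
    (hB : MeasurableSet B) (hμ : μ B ≠ 0) :
    ∀ᵐ x ∂μ, ∃ n : ℕ, ((T : Equiv.Perm X) ^ (-n : ℤ)) x ∈ B := by
  filter_upwards [ae_exists_pow_mem (ergodic_inv hE) hB hμ] with x ⟨n, hn⟩
  refine ⟨n, ?_⟩
  rwa [zpow_neg, ← inv_zpow]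

theorem ae_exists_pow_succ_mem (hE : Ergodic (T : Equiv.Perm X) μ) {B : Set X}
    (hB : MeasurableSet B) (hμ : μ B ≠ 0) :
    ∀ᵐ x ∂μ, ∃ n : ℕ, ((T : Equiv.Perm X) ^ (n + 1 : ℤ)) x ∈ B := by
  filter_upwards [T.2.1.quasiMeasurePreserving.ae (ae_exists_pow_mem hE hB hμ)] with x ⟨n, hn⟩
  refine ⟨n, ?_⟩
  rwa [zpow_add, zpow_one]

/-- Counts the integers in `[-a, a]`; this converts the Borel–Cantelli sum into an integral. -/
theorem tsum_indicator_natAbs_le (a : ℝ≥0∞) :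
    ∑' i : ℤ, {i : ℤ | (i.natAbs : ℝ≥0∞) ≤ a}.indicator (1 : ℤ → ℝ≥0∞) i ≤ 2 * a + 1 := by
  rcases eq_or_ne a ∞ with rfl | ha
  · simp
  lift a to NNReal using ha with b
  let n : ℕ := ⌊b⌋₊
  have hiff : ∀ i : ℤ, (i.natAbs : ℝ≥0∞) ≤ b ↔ i.natAbs ≤ n := fun i => by
    rw [Nat.le_floor_iff (zero_le)]
    exact_mod_cast Iff.rfl
  rw [tsum_eq_sum (s := Finset.Icc (-n : ℤ) n)]
  · calc _ ≤ ∑ i ∈ Finset.Icc (-n : ℤ) n, (1 : ℝ≥0∞) :=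
          Finset.sum_le_sum fun i _ => Set.indicator_le_self' (fun _ _ => zero_le) i
      _ = ((2 * n + 1 : ℕ) : ℝ≥0∞) := by
          rw [Finset.sum_const, Int.card_Icc, nsmul_one]
          congr 1
          omega
      _ ≤ 2 * b + 1 := by
          push_cast
          gcongr
          exact_mod_cast Nat.floor_le (zero_le)
  · intro i hi
    refine Set.indicator_of_notMem (fun h => hi ?_) _
    have := (hiff i).1 h
    rw [Finset.mem_Icc]
    omega

/-- Borel–Cantelli. With `u` the displacement of `S`, invariance gives the `i`-th event the measure
of `{|i| ≤ u}`. Summing over `i` gives at most the integral of `2 * u + 1`, which is finite. -/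
theorem ae_finite_natAbs_le_orbitDist [StandardBorelSpace X] {S : mpPerm μ} (hS : S ∈ preL1 T) :
    ∀ᵐ x ∂μ, {i : ℤ | (i.natAbs : ℝ≥0∞) ≤ orbitDist (T : Equiv.Perm X)
      (((T : Equiv.Perm X) ^ i) x) ((S : Equiv.Perm X) (((T : Equiv.Perm X) ^ i) x))}.Finite := by
  let u : X → ℝ≥0∞ := fun y => orbitDist (T : Equiv.Perm X) y ((S : Equiv.Perm X) y)
  have hu : Measurable u := measurable_orbitDist T 1 S
  have hm : ∀ i : ℤ, MeasurableSet {x | (i.natAbs : ℝ≥0∞) ≤ u x} := fun i =>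
    measurableSet_le measurable_const hu
  refine ae_finite_setOfPred_mem (s := fun i : ℤ =>
    ((T : Equiv.Perm X) ^ i : Equiv.Perm X) ⁻¹' {x | (i.natAbs : ℝ≥0∞) ≤ u x}) ?_
  have h1 : ∑' i : ℤ, μ (((T : Equiv.Perm X) ^ i : Equiv.Perm X) ⁻¹'
      {x | (i.natAbs : ℝ≥0∞) ≤ u x}) ≤ ∫⁻ x, 2 * u x + 1 ∂μ := by
    calc _ = ∑' i : ℤ, ∫⁻ x, {x | (i.natAbs : ℝ≥0∞) ≤ u x}.indicator 1 x ∂μ := by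
          refine tsum_congr fun i => ?_
          rw [(measurePreserving_zpow T i).measure_preimage (hm i).nullMeasurableSet,
            lintegral_indicator_one (hm i)]
      _ = ∫⁻ x, ∑' i : ℤ, {x | (i.natAbs : ℝ≥0∞) ≤ u x}.indicator 1 x ∂μ :=
          (lintegral_tsum fun i => (measurable_one.indicator (hm i)).aemeasurable).symm
      _ ≤ _ := lintegral_mono fun x => tsum_indicator_natAbs_le (u x)
  refine (h1.trans_lt ?_).ne
  rw [lintegral_add_right _ measurable_const, lintegral_const_mul _ hu]
  refine ENNReal.add_lt_top.2 ⟨ENNReal.mul_lt_top (by simp) hS.2, by simp⟩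

end Dynamics

/-! ### Aperiodicity -/

section Aperiodic

variable {X : Type*} [TopologicalSpace X] [SecondCountableTopology X]
  [MeasurableSpace X] [BorelSpace X] {μ : Measure X} [IsProbabilityMeasure μ] [μ.OuterRegular]
  [NullSingletonClass μ] {T : mpPerm μ}

/-- Take a small open neighbourhood of a point of the support: the point is null, so outer
regularity makes the measure small. -/
theorem exists_measurableSet_pos_lt (μ : Measure X) [IsProbabilityMeasure μ] [μ.OuterRegular]
    [NullSingletonClass μ] {ε : ℝ≥0∞} (hε : 0 < ε) :
    ∃ C, MeasurableSet C ∧ μ C ≠ 0 ∧ μ C < ε := by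
  obtain ⟨x, -, hx⟩ := exists_mem_forall_mem_nhdsWithin_pos_measure (μ := μ) (s := Set.univ)
    (by simp)
  obtain ⟨U, hxU, hU, hμU⟩ := Set.exists_isOpen_lt_of_lt (μ := μ) {x} ε (by simpa using hε)
  exact ⟨U, hU.measurableSet, (hx U (mem_nhdsWithin_of_mem_nhds
    (hU.mem_nhds (hxU rfl)))).ne', hμU⟩

variable [T2Space X]

/-- The fixed points of `T ^ n` form an invariant set. If it were conull, then by recurrence `n`
translates of any set of positive measure would cover almost everything, which fails for a set of
measure less than `1 / n`. -/
theorem ae_zpow_ne_self (hE : Ergodic (T : Equiv.Perm X) μ) (n : ℕ) (hn : n ≠ 0) :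
    ∀ᵐ x ∂μ, ((T : Equiv.Perm X) ^ (n : ℤ)) x ≠ x := by
  let P : Set X := {x | ((T : Equiv.Perm X) ^ (n : ℤ)) x = x}
  have hP : MeasurableSet P := measurableSet_eq_fun (measurable_zpow T n) measurable_id
  have hinv : (T : Equiv.Perm X) ⁻¹' P = P := by
    ext x
    change ((T : Equiv.Perm X) ^ (n : ℤ)) ((T : Equiv.Perm X) x) = (T : Equiv.Perm X) x ↔ _ = _
    rw [← Equiv.Perm.mul_apply, (Commute.zpow_self (T : Equiv.Perm X) n).eq, Equiv.Perm.mul_apply,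
      Equiv.apply_eq_iff_eq]
  rcases hE.toPreErgodic.ae_mem_or_ae_notMem hP hinv with h | h
  · exfalso
    obtain ⟨C, hC, hC0, hμC⟩ := exists_measurableSet_pos_lt μ (ε := 1 / n)
      (ENNReal.div_pos one_ne_zero (ENNReal.natCast_ne_top n))
    have hcov : ∀ᵐ x ∂μ, x ∈ ⋃ i ∈ Finset.range n,
        ((T : Equiv.Perm X) ^ (i : ℤ) : Equiv.Perm X) ⁻¹' C := by
      filter_upwards [h, ae_exists_pow_mem hE hC hC0] with x hx ⟨k, hk⟩
      -- On a point fixed by `T ^ n` a visit at time `k` is also one at time `k % n`.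
      refine Set.mem_biUnion (x := k % n)
        (Finset.mem_coe.2 (Finset.mem_range.2 (Nat.mod_lt _ (Nat.pos_of_ne_zero hn)))) ?_
      have hxn : ((T : Equiv.Perm X) ^ (n : ℤ)) x = x := hx
      have : ((T : Equiv.Perm X) ^ ((n : ℤ) * (k / n : ℕ))) x = x := by
        rw [zpow_mul]
        exact Equiv.Perm.zpow_apply_eq_self_of_apply_eq_self hxn _
      change ((T : Equiv.Perm X) ^ ((k % n : ℕ) : ℤ)) x ∈ C
      have h2 : (k : ℤ) = (k % n : ℕ) + (n : ℤ) * (k / n : ℕ) := by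
        exact_mod_cast (Nat.mod_add_div k n).symm
      rw [h2, zpow_add, Equiv.Perm.mul_apply, this] at hk
      exact hk
    have h1 : (1 : ℝ≥0∞) ≤ n * μ C := by
      calc (1 : ℝ≥0∞) = μ (⋃ i ∈ Finset.range n,
            ((T : Equiv.Perm X) ^ (i : ℤ) : Equiv.Perm X) ⁻¹' C) := by
            rw [← measure_univ (μ := μ)]
            exact (measure_congr (eventuallyEq_univ.2 hcov)).symm
        _ ≤ ∑ i ∈ Finset.range n, μ (((T : Equiv.Perm X) ^ (i : ℤ) : Equiv.Perm X) ⁻¹' C) :=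
            measure_biUnion_finset_le _ _
        _ = n * μ C := by
            have hi : ∀ i ∈ Finset.range n,
                μ (((T : Equiv.Perm X) ^ (i : ℤ) : Equiv.Perm X) ⁻¹' C) = μ C := fun i _ =>
              (measurePreserving_zpow T i).measure_preimage hC.nullMeasurableSet
            rw [Finset.sum_congr rfl hi]
            simp
    refine h1.not_gt ?_
    rw [mul_comm]
    exact ENNReal.mul_lt_of_lt_div hμC
  · exact h

/-- An ergodic transformation of a non-atomic probability space is aperiodic. -/
theorem ae_zpow_injective (hE : Ergodic (T : Equiv.Perm X) μ) :
    ∀ᵐ x ∂μ, ∀ i j : ℤ, ((T : Equiv.Perm X) ^ i) x = ((T : Equiv.Perm X) ^ j) x → i = j := by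
  have h : ∀ᵐ x ∂μ, ∀ n : ℕ, n ≠ 0 → ((T : Equiv.Perm X) ^ (n : ℤ)) x ≠ x :=
    ae_all_iff.2 fun n => by
      by_cases hn : n = 0
      · simp [hn]
      · filter_upwards [ae_zpow_ne_self hE n hn] with x hx _ using hx
  filter_upwards [h] with x hx
  have key : ∀ i j : ℤ, ((T : Equiv.Perm X) ^ i) x = ((T : Equiv.Perm X) ^ j) x → i ≤ j := by
    intro i j hij
    by_contra! hlt
    refine hx (i - j).toNat (by omega) ?_
    rw [Int.toNat_of_nonneg (by omega), sub_eq_neg_add, zpow_add, Equiv.Perm.mul_apply, hij,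
      zpow_neg_apply_eq_iff]
  exact fun i j hij => le_antisymm (key i j hij) (key j i hij.symm)

end Aperiodic

/-! ### Correcting the finitely many crossings of the origin -/

section Pattern

/-- A set of integers which agrees with the negative integers up to a finite set is, up to a
permutation of finite support, a left half-line. -/
theorem exists_perm_mem_iff_lt {A : Set ℤ} (hA : {i : ℤ | ¬(i ∈ A ↔ i < 0)}.Finite) :
    ∃ (M : ℕ) (k : ℤ) (σ : Equiv.Perm (Finset.Ico (-M : ℤ) M)), -M ≤ k ∧ k ≤ M ∧
      ∀ p : ℤ, σ.ofSubtype p ∈ A ↔ p < k := by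
  classical
  obtain ⟨M, hM⟩ : ∃ M : ℕ, ∀ i : ℤ, i ∉ Finset.Ico (-M : ℤ) M → (i ∈ A ↔ i < 0) := by
    refine ⟨hA.toFinset.sup Int.natAbs + 1, fun i hi => ?_⟩
    by_contra hcon
    have hle : i.natAbs ≤ hA.toFinset.sup Int.natAbs :=
      Finset.le_sup (f := Int.natAbs) (hA.mem_toFinset.2 hcon)
    refine hi (Finset.mem_Ico.2 ?_)
    push_cast
    omega
  let W : Finset ℤ := Finset.Ico (-M : ℤ) M
  let m : ℕ := (W.filter (· ∈ A)).card
  have hm : m ≤ 2 * M := by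
    refine (Finset.card_filter_le _ _).trans ?_
    rw [Int.card_Ico]
    omega
  -- With this cut, `[-M, k)` has as many elements as the part of `A` in the window. A bijection
  -- between the two extends to a permutation of the window.
  let k : ℤ := -M + m
  have hsub : ∀ P : ℤ → Prop, Nat.card {p : W // P p} = (W.filter P).card := fun P => by
    rw [Nat.card_congr (Equiv.subtypeSubtypeEquivSubtypeInter (· ∈ W) P)]
    exact Nat.subtype_card _ fun x => by simp
  have hcard : Nat.card {p : W // (p : ℤ) < k} = Nat.card {p : W // (p : ℤ) ∈ A} := by
    rw [hsub (· < k), hsub (· ∈ A)]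
    trans (Finset.Ico (-M : ℤ) k).card
    · congr 1
      ext i
      simp only [W, Finset.mem_filter, Finset.mem_Ico]
      omega
    · rw [Int.card_Ico]
      omega
  obtain ⟨e⟩ := Finite.card_eq.1 hcard
  refine ⟨M, k, e.extendSubtype, by omega, by omega, fun p => ?_⟩
  by_cases hp : p ∈ W
  · rw [Equiv.Perm.ofSubtype_apply_of_mem _ hp]
    by_cases hpk : p < k
    · exact iff_of_true (e.extendSubtype_mem ⟨p, hp⟩ hpk) hpk
    · exact iff_of_false (e.extendSubtype_not_mem ⟨p, hp⟩ hpk) hpk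
  · rw [Equiv.Perm.ofSubtype_apply_of_not_mem _ hp, hM p hp]
    rw [Finset.mem_Ico] at hp
    omega

theorem ofSubtype_apply_of_notMem {W : Finset ℤ} (σ : Equiv.Perm W) (i : ℤ) (hi : i ∉ W) :
    σ.ofSubtype i = i :=
  Equiv.Perm.ofSubtype_apply_of_not_mem σ hi

/-- The points `x` such that `S` moves the points `T ^ (a p) x` with `p < k` to the negative half
of the orbit of `x`, and those with `k ≤ p` to the nonnegative half. -/
def sideSet {X : Type*} (T S : Equiv.Perm X) (a : ℤ → ℤ) (k : ℤ) : Set X :=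
  {x | ∀ p : ℤ, ∃ j : ℤ, S ((T ^ a p) x) = (T ^ j) x ∧ (j < 0 ↔ p < k)}

variable {X : Type*} [MeasurableSpace X] [StandardBorelSpace X] {μ : Measure X} {T : mpPerm μ}

theorem measurableSet_sideSet (T S : mpPerm μ) (a : ℤ → ℤ) (k : ℤ) :
    MeasurableSet (sideSet (T : Equiv.Perm X) S a k) := by
  have : sideSet (T : Equiv.Perm X) S a k = ⋂ p : ℤ, ⋃ j ∈ {j : ℤ | j < 0 ↔ p < k},
      {x | (S : Equiv.Perm X) (((T : Equiv.Perm X) ^ a p) x) = ((T : Equiv.Perm X) ^ j) x} := by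
    ext x
    simp [sideSet, and_comm]
  rw [this]
  exact MeasurableSet.iInter fun p => MeasurableSet.biUnion (Set.to_countable _) fun j _ =>
    measurableSet_eq_fun (S.2.1.measurable.comp (measurable_zpow T _)) (measurable_zpow T j)

theorem natAbs_le_orbitDist {Y : Type*} {T : Equiv.Perm Y} {x : Y}
    (hx : ∀ i j : ℤ, (T ^ i) x = (T ^ j) x → i = j) (i j : ℤ) :
    ((j - i).natAbs : ℝ≥0∞) ≤ orbitDist T ((T ^ i) x) ((T ^ j) x) := by
  refine le_iInf₂ fun n hn => ?_
  rw [← Equiv.Perm.mul_apply, ← zpow_add] at hn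
  have := hx _ _ hn
  have h : j - i = n := by omega
  rw [h]

/-- Let `S` send index `i` of a free orbit to `s i`. If exactly one of `i`, `s i` is negative, then
`|i| ≤ |s i - i|`, which happens for finitely many `i` only. Hence `{i | s i < 0}` is a finite
perturbation of the negative integers. -/
theorem ae_exists_mem_sideSet [IsProbabilityMeasure μ]
    (hap : ∀ᵐ x ∂μ, ∀ i j : ℤ, ((T : Equiv.Perm X) ^ i) x = ((T : Equiv.Perm X) ^ j) x → i = j)
    {S : mpPerm μ} (hS : S ∈ preL1 T) :
    ∀ᵐ x ∂μ, ∃ (M : ℕ) (k : ℤ) (σ : Equiv.Perm (Finset.Ico (-M : ℤ) M)), -M ≤ k ∧ k ≤ M ∧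
      x ∈ sideSet (T : Equiv.Perm X) S σ.ofSubtype k := by
  have horb : ∀ᵐ x ∂μ, ∀ i : ℤ, ∃ j : ℤ,
      ((T : Equiv.Perm X) ^ j) x = (S : Equiv.Perm X) (((T : Equiv.Perm X) ^ i) x) := by
    refine ae_all_iff.2 fun i => ?_
    filter_upwards [(measurePreserving_zpow T i).quasiMeasurePreserving.ae hS.1] with x ⟨n, hn⟩
    exact ⟨n + i, by rw [zpow_add, Equiv.Perm.mul_apply, hn]⟩
  filter_upwards [hap, horb, ae_finite_natAbs_le_orbitDist hS] with x hx hs hfin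
  choose s hs using hs
  obtain ⟨M, k, σ, h1, h2, h3⟩ := exists_perm_mem_iff_lt (A := {i | s i < 0}) <| by
    refine hfin.subset fun i hi => ?_
    have hle := natAbs_le_orbitDist hx i (s i)
    rw [hs i] at hle
    refine le_trans (Nat.cast_le.2 ?_) hle
    simp only [Set.mem_ofPred_eq] at hi
    omega
  exact ⟨M, k, σ, h1, h2, fun p => ⟨s (σ.ofSubtype p), (hs _).symm, h3 p⟩⟩

/-- There are only countably many triples `(M, k, σ)`, and their sets cover almost every point. -/
theorem exists_measure_sideSet_ne_zero [IsProbabilityMeasure μ]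
    (hap : ∀ᵐ x ∂μ, ∀ i j : ℤ, ((T : Equiv.Perm X) ^ i) x = ((T : Equiv.Perm X) ^ j) x → i = j)
    {S : mpPerm μ} (hS : S ∈ preL1 T) :
    ∃ (M : ℕ) (k : ℤ) (σ : Equiv.Perm (Finset.Ico (-M : ℤ) M)), -M ≤ k ∧ k ≤ M ∧
      μ (sideSet (T : Equiv.Perm X) S σ.ofSubtype k) ≠ 0 := by
  by_contra! hcon
  have h : ∀ᵐ x ∂μ, ∀ (M : ℕ) (k : ℤ) (σ : Equiv.Perm (Finset.Ico (-M : ℤ) M)), -M ≤ k → k ≤ M →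
      x ∉ sideSet (T : Equiv.Perm X) S σ.ofSubtype k := by
    simp only [ae_all_iff]
    intro M k σ h1 h2
    exact measure_eq_zero_iff_ae_notMem.1 (hcon M k σ h1 h2)
  have hfalse : ∀ᵐ _ ∂μ, False := by
    filter_upwards [h, ae_exists_mem_sideSet hap hS] with x hx ⟨M, k, σ, h1, h2, h3⟩
    exact hx M k σ h1 h2 h3
  exact hfalse.exists.choose_spec

omit [StandardBorelSpace X] in
/-- Every set of positive measure has a subset of positive measure with long return times. -/
theorem exists_subset_forall_zpow_notMem [TopologicalSpace X] [SecondCountableTopology X]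
    [T2Space X] [BorelSpace X] (hc : ∀ n : ℤ, Continuous ((T : Equiv.Perm X) ^ n : Equiv.Perm X))
    (hap : ∀ᵐ x ∂μ, ∀ i j : ℤ, ((T : Equiv.Perm X) ^ i) x = ((T : Equiv.Perm X) ^ j) x → i = j)
    {E : Set X} (hE : MeasurableSet E) (hμ : μ E ≠ 0) (D : Finset ℤ) (hD : 0 ∉ D) :
    ∃ B ⊆ E, MeasurableSet B ∧ μ B ≠ 0 ∧
      ∀ d ∈ D, ∀ b ∈ B, ((T : Equiv.Perm X) ^ d) b ∉ B := by
  let N : Set X :=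
    {x | ∀ i j : ℤ, ((T : Equiv.Perm X) ^ i) x = ((T : Equiv.Perm X) ^ j) x → i = j}
  have hEN : μ (E ∩ N) ≠ 0 := by
    have h : (E ∩ N : Set X) =ᵐ[μ] E := inter_eventuallyEq_left.2 (hap.mono fun x hx _ => hx)
    rwa [measure_congr h]
  -- A point with free orbit all of whose neighbourhoods meet `E ∩ N` in positive measure. A small
  -- neighbourhood of it is disjoint from its translates by the finitely many `d`.
  obtain ⟨x, ⟨hxE, hxN⟩, hx⟩ := exists_mem_forall_mem_nhdsWithin_pos_measure hEN
  have hU : ∀ d ∈ D, ∃ U : Set X, IsOpen U ∧ x ∈ U ∧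
      ∀ b ∈ U, ((T : Equiv.Perm X) ^ d) b ∉ U := by
    intro d hd
    have hne : ((T : Equiv.Perm X) ^ d) x ≠ x := fun h => by
      have : d = 0 := hxN d 0 (by simpa using h)
      exact hD (this ▸ hd)
    obtain ⟨u, v, hu, hv, hxu, hxv, huv⟩ := t2_separation hne
    refine ⟨v ∩ ((T : Equiv.Perm X) ^ d : Equiv.Perm X) ⁻¹' u, hv.inter (hu.preimage (hc d)),
      ⟨hxv, hxu⟩, fun b hb hb' => ?_⟩
    exact Set.disjoint_left.1 huv hb.2 hb'.1
  choose! U hUo hxU hUd using hU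
  have hUo' : IsOpen (⋂ d ∈ D, U d) := isOpen_biInter_finset hUo
  have hxU' : x ∈ ⋂ d ∈ D, U d := Set.mem_iInter₂.2 hxU
  refine ⟨E ∩ ⋂ d ∈ D, U d, Set.inter_subset_left, hE.inter hUo'.measurableSet, ?_, ?_⟩
  · refine (lt_of_lt_of_le (hx ((E ∩ N) ∩ ⋂ d ∈ D, U d) ?_) (measure_mono ?_)).ne'
    · exact inter_mem_nhdsWithin _ (hUo'.mem_nhds hxU')
    · exact Set.inter_subset_inter_left _ Set.inter_subset_left
  · intro d hd b hb hb'
    exact hUd d hd b (Set.mem_iInter₂.1 hb.2 d hd) (Set.mem_iInter₂.1 hb'.2 d hd)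

end Pattern

/-- Composing `S` with a permutation of the windows around the points of `B` and with a power of
`T`, one obtains a permutation which preserves the two halves of the orbit of each point of `B`. -/
theorem subset_sideSet_mul {X : Type*} {T S : Equiv.Perm X} {M : ℕ} {k : ℤ}
    {σ : Equiv.Perm (Finset.Ico (-M : ℤ) M)} {B : Set X} (hk : -M ≤ k) (hk' : k ≤ M)
    (hB : B ⊆ sideSet T S σ.ofSubtype k) (hW : IsTower T (Finset.Ico (-M : ℤ) M) B)
    (hret : ∀ d : ℤ, d ≠ 0 → d.natAbs < 2 * M → ∀ b ∈ B, (T ^ d) b ∉ B) :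
    B ⊆ sideSet T (S * towerPerm hW (ofSubtype_apply_of_notMem σ) * T ^ k) id 0 := by
  intro b hb p
  have hTp : (T ^ k) ((T ^ p) b) = (T ^ (p + k)) b := by
    rw [← Equiv.Perm.mul_apply, ← zpow_add, add_comm]
  -- Here `q` is the index reached before `S` is applied, and `r` its preimage under `σ`: the side
  -- on which `S` puts index `q` is read off from `r < k`.
  suffices h : ∃ q r : ℤ, towerMap T (Finset.Ico (-M : ℤ) M) σ.ofSubtype B ((T ^ (p + k)) b) =
      (T ^ q) b ∧ σ.ofSubtype r = q ∧ (r < k ↔ p < 0) by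
    obtain ⟨q, r, h1, h2, h3⟩ := h
    obtain ⟨j, hj, hj'⟩ := hB hb r
    refine ⟨j, ?_, hj'.trans h3⟩
    rw [← hj, h2, ← h1, ← hTp]
    rfl
  by_cases hp : p + k ∈ Finset.Ico (-M : ℤ) M
  · exact ⟨_, p + k, towerMap_zpow_apply hW hp hb, rfl, by omega⟩
  -- The point may lie in the window of another point `a` of `B` on the same orbit. That window is
  -- at least `2 * M` steps away, hence entirely on one side of the window of `b`, and permuting it
  -- does not change the side.
  by_cases hex : ∃ i ∈ Finset.Ico (-M : ℤ) M, ∃ a ∈ B, (T ^ i) a = (T ^ (p + k)) b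
  · obtain ⟨i, hi, a, ha, hab⟩ := hex
    obtain ⟨d, hd⟩ : ∃ d, d = p + k - i := ⟨_, rfl⟩
    have had : a = (T ^ d) b := by
      rw [← (zpow_neg_apply_eq_iff T i _ _).2 hab, ← Equiv.Perm.mul_apply, ← zpow_add, hd]
      congr 2
      ring
    have hd0 : d ≠ 0 := by
      rintro rfl
      exact hp (by rwa [← sub_eq_zero.1 hd.symm] at hi)
    have hdM : 2 * M ≤ d.natAbs := by
      by_contra! hlt
      exact hret d hd0 hlt b hb (had ▸ ha)
    have hσi : σ.ofSubtype i ∈ Finset.Ico (-M : ℤ) M :=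
      apply_mem_of_forall_notMem (ofSubtype_apply_of_notMem σ) hi
    have hr : σ.ofSubtype i + d ∉ Finset.Ico (-M : ℤ) M := by
      rw [Finset.mem_Ico] at *
      omega
    refine ⟨σ.ofSubtype i + d, σ.ofSubtype i + d, ?_, ofSubtype_apply_of_notMem σ _ hr, ?_⟩
    · rw [← hab, towerMap_zpow_apply hW hi ha, had, ← Equiv.Perm.mul_apply, ← zpow_add]
    · rw [Finset.mem_Ico] at *
      omega
  · push Not at hex
    exact ⟨p + k, p + k, towerMap_eq_self hex, ofSubtype_apply_of_notMem σ _ hp, by omega⟩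

/-! ### Gluing countably many pieces -/

section Pieces

variable {X : Type*} [MeasurableSpace X] [StandardBorelSpace X] {μ : Measure X} {T : mpPerm μ}
  {ι : Type*} {Z : ι → Set X} {P : ι → mpPerm μ} {S : mpPerm μ}

/-- The maps `P a` live on disjoint invariant sets, so the product over `F` acts as `S` on the
chosen pieces and trivially elsewhere. -/
theorem exists_finite_pieces (K : Subgroup (l1FullGroup T))
    (hZd : Pairwise (Function.onFun Disjoint Z)) (hP : ∀ a, P a ∈ preL1 T)
    (hPK : ∀ a, l1mk T (P a) (hP a) ∈ K)
    (hPS : ∀ a, ∀ x ∈ Z a, (P a : Equiv.Perm X) x = (S : Equiv.Perm X) x)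
    (hPZ : ∀ a, ∀ x ∈ Z a, (P a : Equiv.Perm X) x ∈ Z a)
    (hPid : ∀ a, ∀ x ∉ Z a, (P a : Equiv.Perm X) x = x) (F : Finset ι) :
    ∃ (f : mpPerm μ) (hf : f ∈ preL1 T), l1mk T f hf ∈ K ∧
      (∀ a ∈ F, ∀ x ∈ Z a, (f : Equiv.Perm X) x = (S : Equiv.Perm X) x) ∧
      ∀ x, (∀ a ∈ F, x ∉ Z a) → (f : Equiv.Perm X) x = x := by
  classical
  induction F using Finset.induction_on with
  | empty => exact ⟨1, one_mem _, one_mem K, by simp, fun x _ => rfl⟩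
  | insert a F ha ih =>
    obtain ⟨f, hf, hfK, hfS, hfid⟩ := ih
    refine ⟨P a * f, mul_mem (hP a) hf, ?_, ?_, ?_⟩
    · rw [l1mk_mul T (hP a) hf]
      exact mul_mem (hPK a) hfK
    · intro b hb x hx
      change (P a : Equiv.Perm X) ((f : Equiv.Perm X) x) = _
      rcases Finset.mem_insert.1 hb with rfl | hbF
      · rw [hfid x fun c hc hxc => ?_, hPS b x hx]
        exact Set.disjoint_left.1 (hZd (show c ≠ b from fun h => ha (h ▸ hc))) hxc hx
      · have hne : b ≠ a := fun h => ha (h ▸ hbF)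
        rw [hfS b hbF x hx, ← hPS b x hx]
        exact hPid a _ (Set.disjoint_left.1 (hZd hne) (hPZ b x hx))
    · intro x hx
      change (P a : Equiv.Perm X) ((f : Equiv.Perm X) x) = _
      rw [hfid x fun c hc => hx c (Finset.mem_insert_of_mem hc),
        hPid a x (hx a (Finset.mem_insert_self a F))]

/-- An element of `[T]₁` which preserves the members of a countable partition and whose
restrictions to these members belong to a closed subgroup belongs to this subgroup. -/
theorem l1mk_mem_of_pieces [Countable ι] (K : Subgroup (l1FullGroup T))
    (hK : IsClosed (K : Set (l1FullGroup T))) (hS : S ∈ preL1 T)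
    (hZ : ∀ a, MeasurableSet (Z a)) (hZu : ∀ᵐ x ∂μ, ∃ a, x ∈ Z a)
    (hZd : Pairwise (Function.onFun Disjoint Z)) (hP : ∀ a, P a ∈ preL1 T)
    (hPK : ∀ a, l1mk T (P a) (hP a) ∈ K)
    (hPS : ∀ a, ∀ x ∈ Z a, (P a : Equiv.Perm X) x = (S : Equiv.Perm X) x)
    (hPZ : ∀ a, ∀ x ∈ Z a, (P a : Equiv.Perm X) x ∈ Z a)
    (hPid : ∀ a, ∀ x ∉ Z a, (P a : Equiv.Perm X) x = x) :
    l1mk T S hS ∈ K := by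
  classical
  have hint : ∀ u : X → ℝ≥0∞, ∫⁻ x, u x ∂μ = ∑' a, ∫⁻ x in Z a, u x ∂μ := fun u => by
    rw [← lintegral_iUnion hZ hZd, ← setLIntegral_univ]
    refine setLIntegral_congr (eventuallyEq_univ.2 ?_).symm
    exact hZu.mono fun x hx => Set.mem_iUnion.2 hx
  let u : X → ℝ≥0∞ := fun x => orbitDist (T : Equiv.Perm X) ((S : Equiv.Perm X) x) x
  have hu : ∑' a, ∫⁻ x in Z a, u x ∂μ ≠ ∞ := by
    rw [← hint]
    have : preEDist T S 1 < ∞ := by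
      rw [preEDist_comm]
      exact hS.2
    exact this.ne
  rw [← SetLike.mem_coe, ← hK.closure_eq]
  refine EMetric.mem_closure_iff.2 fun ε hε => ?_
  -- The finite product agrees with `S` on the pieces in `F` and is the identity on the others, so
  -- its distance to `S` is the tail of the convergent series `hu`.
  obtain ⟨F, hF⟩ := ((ENNReal.tendsto_tsum_compl_atTop_zero hu).eventually_lt_const hε).exists
  obtain ⟨f, hf, hfK, hfS, hfid⟩ := exists_finite_pieces K hZd hP hPK hPS hPZ hPid F
  refine ⟨_, hfK, lt_of_le_of_lt ?_ hF⟩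
  rw [edist_l1mk, preEDist, hint]
  refine le_of_le_of_eq ?_ (tsum_subtype {a | a ∉ F} fun a => ∫⁻ x in Z a, u x ∂μ).symm
  refine ENNReal.tsum_le_tsum fun a => ?_
  by_cases ha : a ∈ F
  · refine le_of_eq_of_le ?_ zero_le
    rw [setLIntegral_congr_fun (g := fun _ => 0) (hZ a) fun x hx => ?_, lintegral_zero]
    simp only [hfS a ha x hx, orbitDist_self]
  · rw [Set.indicator_of_mem (show a ∈ {a | a ∉ F} from ha)]
    refine (setLIntegral_congr_fun (hZ a) fun x hx => ?_).le
    simp only [u]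
    rw [hfid x fun b hb hxb => ?_]
    exact Set.disjoint_left.1 (hZd (show b ≠ a from fun h => ha (h ▸ hb))) hxb hx

end Pieces

/-! ### Cutting orbits at the visits to `B` -/

section Returns

variable {X : Type*} {T S : Equiv.Perm X} {B : Set X}

/-- The points of `B` which return to `B` after `n` steps and on whose first `n` iterates `S` acts
as `σ`. -/
def returnSet (T S : Equiv.Perm X) (B : Set X) (n : ℕ) (σ : Equiv.Perm (Finset.Ico (0 : ℤ) n)) :
    Set X :=
  {b | b ∈ B ∧ (T ^ (n : ℤ)) b ∈ B ∧ (∀ i : ℤ, 0 < i → i < n → (T ^ i) b ∉ B) ∧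
    ∀ i ∈ Finset.Ico (0 : ℤ) n, S ((T ^ i) b) = (T ^ σ.ofSubtype i) b}

/-- The union of the tower of height `n` over a set. -/
def towerUnion (T : Equiv.Perm X) (W : Finset ℤ) (A : Set X) : Set X :=
  {x | ∃ i ∈ W, ∃ a ∈ A, (T ^ i) a = x}

/-- Otherwise `a` would be a visit of the orbit of `a'` to `B` strictly before the return time `n'`.
Applied in both directions, this shows that a point determines its level. -/
theorem returnSet_aux {n n' : ℕ} {σ : Equiv.Perm (Finset.Ico (0 : ℤ) n)}
    {σ' : Equiv.Perm (Finset.Ico (0 : ℤ) n')} {a a' : X} (ha : a ∈ returnSet T S B n σ)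
    (ha' : a' ∈ returnSet T S B n' σ') {i j : ℤ} (hi : i ∈ Finset.Ico (0 : ℤ) n)
    (hj : j ∈ Finset.Ico (0 : ℤ) n') (h : (T ^ i) a = (T ^ j) a') : j ≤ i := by
  by_contra! hlt
  rw [Finset.mem_Ico] at hi hj
  refine ha'.2.2.1 (j - i) (by omega) (by omega) ?_
  have : (T ^ (j - i)) a' = a := by
    rw [sub_eq_neg_add, zpow_add, Equiv.Perm.mul_apply, ← h, zpow_neg_apply_eq_iff]
  rw [this]
  exact ha.1

theorem isTower_returnSet (n : ℕ) (σ : Equiv.Perm (Finset.Ico (0 : ℤ) n)) :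
    IsTower T (Finset.Ico (0 : ℤ) n) (returnSet T S B n σ) :=
  fun _ hi _ hj _ ha _ hb hab =>
    le_antisymm (returnSet_aux hb ha hj hi hab.symm) (returnSet_aux ha hb hi hj hab)

/-- The height is the first return time, and `S` determines `σ` because the levels are disjoint.
Positivity matters, as the return set of height `0` is all of `B`. -/
theorem sigma_eq_of_mem_returnSet {n n' : ℕ} {σ : Equiv.Perm (Finset.Ico (0 : ℤ) n)}
    {σ' : Equiv.Perm (Finset.Ico (0 : ℤ) n')} {a : X} (ha : a ∈ returnSet T S B n σ)
    (ha' : a ∈ returnSet T S B n' σ') (hn : 0 < n) (hn' : 0 < n') :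
    (⟨n, σ⟩ : Σ n : ℕ, Equiv.Perm (Finset.Ico (0 : ℤ) n)) = ⟨n', σ'⟩ := by
  obtain rfl : n = n' := by
    rcases lt_trichotomy n n' with h | h | h
    · exact (ha'.2.2.1 n (by omega) (by omega) ha.2.1).elim
    · exact h
    · exact (ha.2.2.1 n' (by omega) (by omega) ha'.2.1).elim
  congr 1
  ext ⟨i, hi⟩
  have h1 := ha.2.2.2 i hi
  rw [ha'.2.2.2 i hi, Equiv.Perm.ofSubtype_apply_of_mem _ hi,
    Equiv.Perm.ofSubtype_apply_of_mem _ hi] at h1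
  exact (isTower_returnSet n σ _ (σ' ⟨i, hi⟩).2 _ (σ ⟨i, hi⟩).2 a ha a ha h1).symm

theorem pairwise_disjoint_towerUnion_returnSet :
    Pairwise (Function.onFun Disjoint fun s : Σ n : ℕ, Equiv.Perm (Finset.Ico (0 : ℤ) n) =>
      towerUnion T (Finset.Ico (0 : ℤ) s.1) (returnSet T S B s.1 s.2)) := by
  rintro ⟨n, σ⟩ ⟨n', σ'⟩ hne
  refine Set.disjoint_left.2 ?_
  rintro x ⟨i, hi, a, ha, rfl⟩ ⟨j, hj, a', ha', h⟩
  obtain rfl : i = j :=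
    le_antisymm (returnSet_aux ha' ha hj hi h) (returnSet_aux ha ha' hi hj h.symm)
  obtain rfl := (T ^ i).injective h
  have hn := (Finset.mem_Ico.1 hi).1.trans_lt (Finset.mem_Ico.1 hi).2
  have hn' := (Finset.mem_Ico.1 hj).1.trans_lt (Finset.mem_Ico.1 hj).2
  exact hne (sigma_eq_of_mem_returnSet ha ha' (Int.natCast_pos.1 hn) (Int.natCast_pos.1 hn'))

/-- Rewrites the cut at `T ^ n b` in the indexing of the orbit based at `b`. -/
theorem mem_sideSet_zpow_iff {b : X} (hx : ∀ i j : ℤ, (T ^ i) b = (T ^ j) b → i = j) {n i j : ℤ}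
    (hn : (T ^ n) b ∈ sideSet T S id 0) (hij : S ((T ^ i) b) = (T ^ j) b) : j < n ↔ i < n := by
  obtain ⟨l, hl, hl'⟩ := hn (i - n)
  rw [id, zpow_sub_apply_zpow, hij, ← Equiv.Perm.mul_apply, ← zpow_add] at hl
  have := hx _ _ hl
  omega

/-- Respecting the cuts at `b` and at `T ^ n b`, the map `S` sends the segment `[0, n)` into itself.
Being injective on a finite set, it permutes the segment. -/
theorem exists_mem_returnSet {b : X} (hx : ∀ i j : ℤ, (T ^ i) b = (T ^ j) b → i = j)
    (hB : B ⊆ sideSet T S id 0) {n : ℕ} (hb : b ∈ B) (hn : (T ^ (n : ℤ)) b ∈ B)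
    (hret : ∀ i : ℤ, 0 < i → i < n → (T ^ i) b ∉ B) : ∃ σ, b ∈ returnSet T S B n σ := by
  choose s hs hs' using hB hb
  have hmem : ∀ i : Finset.Ico (0 : ℤ) n, s i ∈ Finset.Ico (0 : ℤ) n := by
    rintro ⟨i, hi⟩
    rw [Finset.mem_Ico] at hi ⊢
    have h1 := hs' i
    have h2 := mem_sideSet_zpow_iff hx (hB hn) (hs i)
    simp only [id] at *
    omega
  let g : Finset.Ico (0 : ℤ) n → Finset.Ico (0 : ℤ) n := fun i => ⟨s i, hmem i⟩
  have hg : Function.Injective g := by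
    intro i j hij
    have h : s i = s j := congrArg Subtype.val hij
    have h2 := hs i
    rw [h, ← hs j] at h2
    exact Subtype.ext (hx _ _ (S.injective h2))
  refine ⟨Equiv.ofBijective g (Finite.injective_iff_bijective.1 hg), hb, hn, hret, fun i hi => ?_⟩
  rw [Equiv.Perm.ofSubtype_apply_of_mem _ hi]
  exact hs i

theorem exists_mem_towerUnion_returnSet {x : X}
    (hx : ∀ i j : ℤ, (T ^ i) x = (T ^ j) x → i = j) (hB : B ⊆ sideSet T S id 0)
    (hpast : ∃ n : ℕ, (T ^ (-n : ℤ)) x ∈ B) (hfut : ∃ n : ℕ, (T ^ (n + 1 : ℤ)) x ∈ B) :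
    ∃ s : Σ n : ℕ, Equiv.Perm (Finset.Ico (0 : ℤ) n),
      x ∈ towerUnion T (Finset.Ico (0 : ℤ) s.1) (returnSet T S B s.1 s.2) := by
  classical
  obtain ⟨m, hm, hm'⟩ : ∃ m : ℕ, (T ^ (-m : ℤ)) x ∈ B ∧ ∀ l < m, (T ^ (-l : ℤ)) x ∉ B :=
    ⟨Nat.find hpast, Nat.find_spec hpast, fun l hl => Nat.find_min hpast hl⟩
  -- The last visit may be at time `0` but the next one must be later, so a point of `B` opens a new
  -- segment. Thus `x` sits at level `m` of a tower of height `m + n + 1`.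
  obtain ⟨n, hn, hn'⟩ : ∃ n : ℕ, (T ^ (n + 1 : ℤ)) x ∈ B ∧ ∀ l < n, (T ^ (l + 1 : ℤ)) x ∉ B :=
    ⟨Nat.find hfut, Nat.find_spec hfut, fun l hl => Nat.find_min hfut hl⟩
  have hT : ∀ i : ℤ, (T ^ i) ((T ^ (-m : ℤ)) x) = (T ^ (i - m)) x := fun i => by
    rw [← Equiv.Perm.mul_apply, ← zpow_add, sub_eq_add_neg]
  have hx' : ∀ i j : ℤ, (T ^ i) ((T ^ (-m : ℤ)) x) = (T ^ j) ((T ^ (-m : ℤ)) x) → i = j := by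
    intro i j hij
    rw [hT, hT] at hij
    have := hx _ _ hij
    omega
  have hfirst : (T ^ ((m + n + 1 : ℕ) : ℤ)) ((T ^ (-m : ℤ)) x) ∈ B := by
    rw [hT]
    convert hn using 3
    push_cast
    ring
  have hret : ∀ i : ℤ, 0 < i → i < (m + n + 1 : ℕ) → (T ^ i) ((T ^ (-m : ℤ)) x) ∉ B := by
    intro i hi hin
    rw [hT]
    push_cast at hin
    rcases le_or_gt i m with h | h
    · have := hm' (m - i).toNat (by omega)
      rwa [Int.toNat_of_nonneg (by omega), neg_sub] at this
    · have := hn' (i - m - 1).toNat (by omega)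
      rwa [Int.toNat_of_nonneg (by omega), sub_add_cancel] at this
  obtain ⟨σ, hσ⟩ := exists_mem_returnSet hx' hB hm hfirst hret
  refine ⟨⟨m + n + 1, σ⟩, m, ?_, _, hσ, ?_⟩
  · rw [Finset.mem_Ico]
    push_cast
    omega
  · rw [hT, sub_self, zpow_zero, Equiv.Perm.one_apply]

end Returns

/-! ### Density of the topological full group -/

section Main

variable {X : Type*} [TopologicalSpace X] [CompactSpace X] [TotallyDisconnectedSpace X]
  [PolishSpace X] [MeasurableSpace X] [BorelSpace X] {μ : Measure X} [IsProbabilityMeasure μ]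

theorem measurableSet_returnSet {X : Type*} [MeasurableSpace X] [StandardBorelSpace X]
    {μ : Measure X} (T S : mpPerm μ) {B : Set X} (hB : MeasurableSet B) (n : ℕ)
    (σ : Equiv.Perm (Finset.Ico (0 : ℤ) n)) :
    MeasurableSet (returnSet (T : Equiv.Perm X) S B n σ) := by
  have : returnSet (T : Equiv.Perm X) S B n σ =
      B ∩ ((T : Equiv.Perm X) ^ (n : ℤ) : Equiv.Perm X) ⁻¹' B ∩
      (⋂ i ∈ {i : ℤ | 0 < i ∧ i < n}, (((T : Equiv.Perm X) ^ i : Equiv.Perm X) ⁻¹' B)ᶜ) ∩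
      ⋂ i ∈ Finset.Ico (0 : ℤ) n, {b | (S : Equiv.Perm X) (((T : Equiv.Perm X) ^ i) b) =
        ((T : Equiv.Perm X) ^ σ.ofSubtype i) b} := by
    ext b
    simp only [returnSet, Set.mem_ofPred_eq, Set.mem_inter_iff, Set.mem_preimage, Set.mem_iInter,
      Set.mem_compl_iff, and_imp]
    tauto
  rw [this]
  refine ((hB.inter (measurable_zpow T n hB)).inter ?_).inter ?_
  · exact MeasurableSet.biInter (Set.to_countable _) fun i _ => (measurable_zpow T i hB).compl
  · exact Finset.measurableSet_biInter _ fun i _ =>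
      measurableSet_eq_fun (S.2.1.measurable.comp (measurable_zpow T i)) (measurable_zpow T _)

theorem measurableSet_towerUnion {X : Type*} [MeasurableSpace X] {μ : Measure X} (T : mpPerm μ)
    (W : Finset ℤ) {A : Set X} (hA : MeasurableSet A) :
    MeasurableSet (towerUnion (T : Equiv.Perm X) W A) := by
  have : towerUnion (T : Equiv.Perm X) W A =
      ⋃ i ∈ W, ((T : Equiv.Perm X) ^ (-i) : Equiv.Perm X) ⁻¹' A := by
    ext x
    simp only [towerUnion, Set.mem_ofPred_eq, Set.mem_iUnion, Set.mem_preimage, exists_prop]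
    refine exists_congr fun i => and_congr_right fun _ => ⟨?_, fun h => ⟨_, h, ?_⟩⟩
    · rintro ⟨a, ha, h⟩
      rwa [(zpow_neg_apply_eq_iff _ i _ _).2 h]
    · exact (zpow_neg_apply_eq_iff _ i _ _).1 rfl
  rw [this]
  exact Finset.measurableSet_biUnion _ fun i _ => measurable_zpow T (-i) hA

variable [NullSingletonClass μ] (T : X ≃ₜ X) (hT : Ergodic T μ)

/-- An element of `[T]₁` which preserves the halves of the orbits of the points of a set of
positive measure belongs to the closure of `[T]_c`. -/
theorem l1mk_mem_closed_of_sideSet {S : mpPerm μ}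
    (hS : S ∈ preL1 (homeoMP T hT.toMeasurePreserving)) {B : Set X} (hBm : MeasurableSet B)
    (hB0 : μ B ≠ 0) (hB : B ⊆ sideSet T.toEquiv S id 0) :
    l1mk (homeoMP T hT.toMeasurePreserving) S hS ∈ closedTopFullGroup T hT.toMeasurePreserving := by
  let T' : mpPerm μ := homeoMP T hT.toMeasurePreserving
  have hE : Ergodic (T' : Equiv.Perm X) μ := hT
  have hm : ∀ s : Σ n : ℕ, Equiv.Perm (Finset.Ico (0 : ℤ) n),
      MeasurableSet (returnSet (T' : Equiv.Perm X) S B s.1 s.2) := fun s =>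
    measurableSet_returnSet T' S hBm s.1 s.2
  refine l1mk_mem_of_pieces
    (Z := fun s : Σ n : ℕ, Equiv.Perm (Finset.Ico (0 : ℤ) n) =>
      towerUnion (T' : Equiv.Perm X) (Finset.Ico (0 : ℤ) s.1) (returnSet T'.1 S.1 B s.1 s.2))
    (P := fun s => towerMP (hm s) (isTower_returnSet s.1 s.2) (ofSubtype_apply_of_notMem s.2))
    _ (Subgroup.isClosed_topologicalClosure _) hS (fun s => measurableSet_towerUnion T' _ (hm s))
    ?_ pairwise_disjoint_towerUnion_returnSet
    (fun s => towerMP_mem_preL1 _ _ _) (fun s => towerMP_mem_closed T _ _ _ _) ?_ ?_ ?_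
  · filter_upwards [ae_zpow_injective hE, ae_exists_zpow_neg_mem hE hBm hB0,
      ae_exists_pow_succ_mem hE hBm hB0] with x h1 h2 h3
    exact exists_mem_towerUnion_returnSet h1 hB h2 h3
  · rintro s _ ⟨i, hi, a, ha, rfl⟩
    exact (towerMap_zpow_apply (isTower_returnSet s.1 s.2) hi ha).trans (ha.2.2.2 i hi).symm
  · rintro s _ ⟨i, hi, a, ha, rfl⟩
    exact ⟨_, apply_mem_of_forall_notMem (ofSubtype_apply_of_notMem s.2) hi, a, ha,
      (towerMap_zpow_apply (isTower_returnSet s.1 s.2) hi ha).symm⟩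
  · intro s x hx
    exact towerMap_eq_self fun i hi a ha hax => hx ⟨i, hi, a, ha, hax⟩

/-- Multiplying `S` by the elements `V` and `T ^ k` of the closed subgroup gives a map that
preserves half-orbits, and the two factors can then be cancelled. -/
theorem l1mk_mem_closed {S : mpPerm μ} (hS : S ∈ preL1 (homeoMP T hT.toMeasurePreserving)) :
    l1mk (homeoMP T hT.toMeasurePreserving) S hS ∈ closedTopFullGroup T hT.toMeasurePreserving := by
  let T' : mpPerm μ := homeoMP T hT.toMeasurePreserving
  have hE : Ergodic (T' : Equiv.Perm X) μ := hT
  have hap := ae_zpow_injective hE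
  obtain ⟨M, k, σ, hk, hk', hμ⟩ := exists_measure_sideSet_ne_zero hap hS
  obtain ⟨B, hBE, hBm, hB0, hBd⟩ := exists_subset_forall_zpow_notMem
    (continuous_toEquiv_zpow T) hap (measurableSet_sideSet T' S σ.ofSubtype k) hμ
    -- Windows `[-M, M)` around two points of an orbit are disjoint once the points are at least `2
    -- * M` steps apart.
    ((Finset.Ioo (-(2 * M : ℤ)) (2 * M)).erase 0) (by simp)
  have hret : ∀ d : ℤ, d ≠ 0 → d.natAbs < 2 * M → ∀ b ∈ B, (T.toEquiv ^ d) b ∉ B := by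
    intro d hd hdM
    refine hBd d (Finset.mem_erase.2 ⟨hd, Finset.mem_Ioo.2 ?_⟩)
    omega
  have hW : IsTower T.toEquiv (Finset.Ico (-M : ℤ) M) B :=
    IsTower.of_forall_sub fun i hi j hj hij a ha => by
      rw [Finset.mem_Ico] at hi hj
      exact hret (i - j) (by omega) (by omega) a ha
  let V : mpPerm μ := towerMP (T := T') hBm hW (ofSubtype_apply_of_notMem σ)
  have hV : V ∈ preL1 T' := towerMP_mem_preL1 _ _ _
  have hVG : l1mk T' V hV ∈ closedTopFullGroup T hT.toMeasurePreserving :=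
    towerMP_mem_closed T _ _ _ _
  have hT' : T' ∈ preL1 T' := homeoMP_mem_preL1 T hT.toMeasurePreserving
  have hTk : T' ^ k ∈ preL1 T' := zpow_mem hT' k
  have hTG : l1mk T' (T' ^ k) hTk ∈ closedTopFullGroup T hT.toMeasurePreserving :=
    zpow_mem (homeoMP_mem_closed T hT.toMeasurePreserving) k
  have hmem := l1mk_mem_closed_of_sideSet T hT (S := S * V * T' ^ k)
    (mul_mem (mul_mem hS hV) hTk) hBm hB0 (subset_sideSet_mul hk hk' hBE hW hret)
  rw [l1mk_mul _ (mul_mem hS hV) hTk, l1mk_mul _ hS hV] at hmem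
  exact (Subgroup.mul_mem_cancel_right _ hVG).1 ((Subgroup.mul_mem_cancel_right _ hTG).1 hmem)

theorem denseRange_topToL1 : DenseRange (topToL1 T hT.toMeasurePreserving) := by
  rintro ⟨_, S, hS, rfl⟩
  exact l1mk_mem_closed T hT hS

end Main

end L1FullGroup

theorem mainTheorem5 (T : (ℕ → Bool) ≃ₜ (ℕ → Bool)) (ν : Measure (ℕ → Bool))
    [IsProbabilityMeasure ν] [NullSingletonClass ν] (hT : Ergodic T ν) :
    DenseRange (L1FullGroup.topToL1 T hT.toMeasurePreserving) ∧
    closure (L1FullGroup.topToL1 T hT.toMeasurePreserving ''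
        (commutator (L1FullGroup.topFullGroup T) : Set (L1FullGroup.topFullGroup T))) =
      closure (commutator (L1FullGroup.l1FullGroup
        (L1FullGroup.homeoMP T hT.toMeasurePreserving)) :
          Set (L1FullGroup.l1FullGroup (L1FullGroup.homeoMP T hT.toMeasurePreserving))) :=
  have : PolishSpace (ℕ → Bool) := ⟨⟩
  have h := L1FullGroup.denseRange_topToL1 T hT
  ⟨h, L1FullGroup.closure_image_commutator _ h⟩
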